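/- Let $d\ge 2$ and $d'\ge 1$ be integers and let $s\in(0,d)$. Let $K:\mathbb{R}^d\setminus\{0\}\to\mathbb{C}^{d'}$ be an $s$-dimensional Calderón–Zygmund kernel, homogeneous of order $-s$; that is, $|K(x)|\le |x|^{-s}$, $K(-x)=-K(x)$ and $K(\lambda x)=\lambda^{-s}K(x)$ for all $x\ne0$ and $\lambda>0$, and for some $\alpha\in(0,1]$ the function $x\mapsto |x|^{s+\alpha}K(x)$ (with value $0$ at $0$) is $\alpha$-Hölder continuous on $\mathbb{R}^d$. Write $K(x)=\Omega(x/|x|)/|x|^s$ with $\Omega:\mathbb{S}^{d-1}\to\mathbb{C}^{d'}$, and suppose that $\Omega\in C^\infty(\mathbb{S}^{d-1})$. Let $m:\mathbb{S}^{d-1}\to\mathbb{C}^{d'}$ be the continuous function for which the Fourier transform of the tempered distribution $K$ satisfies $$\widehat K(\xi)=\frac{m(\xi/|\xi|)}{|\xi|^{d-s}}\quad\text{on }\mathbb{R}^d\setminus\{0\},$$ and suppose that $m(\xi)\neq 0$ for every $\xi\in\mathbb{S}^{d-1}$. Let $\Lambda>0$ and let $\mu$ be a $\Lambda$-nice measure,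 i.e. a locally finite non-negative Borel measure on $\mathbb{R}^d$ with $\mu(B(x,r))\le\Lambda r^s$ for all $x\in\mathbb{R}^d$ and $r>0$. Let $\eta:\mathbb{R}^d\to\mathbb{R}$ be Lipschitz continuous and compactly supported, with $\int\eta\,d\mu=1$ (if $\mu\equiv0$, this last condition is dropped). For every $x\in\mathbb{R}^d$ such that $y\mapsto|x-y|^{-s}$ is locally integrable with respect to $\mu$ (which is the case for Lebesgue-almost every $x$), let $$\overline{T}_\mu(1)(x)=\lim_{k\to\infty}\Bigl[\int K(y-x)\psi_k(y)\,d\mu(y)-\iint K(y-z)\,\tfrac12\bigl[\eta(z)\psi_k(y)-\eta(y)\psi_k(z)\bigr]\,d\mu(y)\,d\mu(z)\Bigr],$$ where $\psi_k$ are Lipschitz continuous, compactly supported functions with $0\le\psi_k\le1$ and $\psi_k\equiv1$ on $B(0,k)$; the limit exists and does not depend on the choice of the sequence $(\psi_k)$. If there is a constant $\Gamma\in\mathbb{C}^{d'}$ such that $\overline{T}_\mu(1)(x)=\Gamma$ for Lebesgue-almost every $x\in\mathbb{R}^d$, then $\mu\equiv0$. -/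

import Mathlib

open MeasureTheory Filter Topology Metric
open scoped NNReal ENNReal ContDiff Manifold FourierTransform SchwartzMap

namespace WienerCZ

noncomputable section

variable {d d' : ℕ}

/-- `K` is an `s`-dimensional Calderón–Zygmund kernel `ℝ^d \ {0} → ℂ^{d'}`; the value `K 0` plays
no role.  In `holder`, the function `x ↦ |x|^{s+α} K(x)` is automatically `0` at the origin. -/
structure IsCZKernel (s : ℝ)
    (K : EuclideanSpace ℝ (Fin d) → EuclideanSpace ℂ (Fin d')) : Prop where
  bound : ∀ x, x ≠ 0 → ‖K x‖ ≤ 1 / ‖x‖ ^ s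
  odd : ∀ x, x ≠ 0 → K (-x) = -K x
  holder : ∃ α : ℝ≥0, 0 < α ∧ α ≤ 1 ∧
    ∃ C : ℝ≥0, HolderWith C α (fun x => ‖x‖ ^ (s + (α : ℝ)) • K x)

/-- Homogeneity of order `-s`: `K (t x) = t^{-s} K x` for `t > 0` and `x ≠ 0`. -/
def IsHomogeneousKernel (s : ℝ)
    (K : EuclideanSpace ℝ (Fin d) → EuclideanSpace ℂ (Fin d')) : Prop :=
  ∀ x, x ≠ 0 → ∀ t : ℝ, 0 < t → K (t • x) = t ^ (-s) • K x

/-- The angular part `Ω` of a homogeneous kernel, that is, the restriction of `K` to the unit sphere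
(so `K x = Ω (x/|x|) / |x|^s` for `x ≠ 0`). -/
def angularPart (K : EuclideanSpace ℝ (Fin d) → EuclideanSpace ℂ (Fin d')) :
    sphere (0 : EuclideanSpace ℝ (Fin d)) 1 → EuclideanSpace ℂ (Fin d') :=
  fun θ => K θ

/-- `Ω ∈ C^∞(S^{d-1})`, for Mathlib's manifold structure on the unit sphere. -/
def SmoothOnSphere (hd : 2 ≤ d)
    (Ω : sphere (0 : EuclideanSpace ℝ (Fin d)) 1 → EuclideanSpace ℂ (Fin d')) : Prop :=
  haveI : Fact (Module.finrank ℝ (EuclideanSpace ℝ (Fin d)) = (d - 1) + 1) :=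
    ⟨by rw [finrank_euclideanSpace_fin]; omega⟩
  ContMDiff (𝓡 (d - 1)) 𝓘(ℝ, EuclideanSpace ℂ (Fin d')) ∞ Ω

/-- The projection `ξ/|ξ|` of a nonzero vector to the unit sphere. -/
def toSphere (ξ : EuclideanSpace ℝ (Fin d)) (hξ : ξ ≠ 0) :
    sphere (0 : EuclideanSpace ℝ (Fin d)) 1 :=
  ⟨‖ξ‖⁻¹ • ξ, by
    rw [mem_sphere_zero_iff_norm, norm_smul, norm_inv, norm_norm,
      inv_mul_cancel₀ (norm_ne_zero_iff.mpr hξ)]⟩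

open Classical in
/-- The function `ξ ↦ m(ξ/|ξ|) / |ξ|^{d-s}` (given the irrelevant value `0` at `ξ = 0`). -/
def homogeneousMultiplier (s : ℝ)
    (m : sphere (0 : EuclideanSpace ℝ (Fin d)) 1 → EuclideanSpace ℂ (Fin d'))
    (ξ : EuclideanSpace ℝ (Fin d)) : EuclideanSpace ℂ (Fin d') :=
  if hξ : ξ = 0 then 0 else (‖ξ‖ ^ ((d : ℝ) - s))⁻¹ • m (toSphere ξ hξ)

/-- `K̂(ξ) = m(ξ/|ξ|) / |ξ|^{d-s}` for `ξ ≠ 0`: away from the origin, the Fourier transform (with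
kernel `e^{-2πi⟨x,ξ⟩}`) of the tempered distribution `K` is the function on the right.  That is,
`⟨K, f̂⟩ = ⟨K̂, f⟩` for all Schwartz functions `f` that vanish near the origin. -/
def HasFourierMultiplier (s : ℝ)
    (K : EuclideanSpace ℝ (Fin d) → EuclideanSpace ℂ (Fin d'))
    (m : sphere (0 : EuclideanSpace ℝ (Fin d)) 1 → EuclideanSpace ℂ (Fin d')) : Prop :=
  ∀ f : 𝓢(EuclideanSpace ℝ (Fin d), ℂ), 0 ∉ tsupport (f : EuclideanSpace ℝ (Fin d) → ℂ) →
    ∫ x, 𝓕 (f : EuclideanSpace ℝ (Fin d) → ℂ) x • K x =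
      ∫ ξ, f ξ • homogeneousMultiplier s m ξ

/-- `μ` is `Λ`-nice (with respect to the dimension `s`). -/
structure IsNice (s Λ : ℝ) (μ : Measure (EuclideanSpace ℝ (Fin d))) : Prop where
  locallyFinite : IsLocallyFiniteMeasure μ
  growth : ∀ x, ∀ r : ℝ, 0 < r → μ (ball x r) ≤ ENNReal.ofReal (Λ * r ^ s)

/-- `η ∈ Lip_0(ℝ^d)`: real-valued, Lipschitz, compactly supported. -/
def IsLipZero (η : EuclideanSpace ℝ (Fin d) → ℝ) : Prop :=
  (∃ C : ℝ≥0, LipschitzWith C η) ∧ HasCompactSupport η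

/-- `ν₀ = ημ` is a balancing measure: `η ∈ Lip_0` and `∫ η dμ = 1`.  For `μ = 0`, where no such `η`
exists and everything below vanishes identically, any `η ∈ Lip_0` is allowed. -/
def IsBalancing (μ : Measure (EuclideanSpace ℝ (Fin d)))
    (η : EuclideanSpace ℝ (Fin d) → ℝ) : Prop :=
  IsLipZero η ∧ (μ ≠ 0 → ∫ x, η x ∂μ = 1)

/-- `δ_x ∈ 𝔐_bounded(μ)`: the function `1/|x - ·|^s` is locally `μ`-integrable (to be used for
measures without atoms, for which the value at `x` itself does not matter). -/
def DiracBounded (s : ℝ) (μ : Measure (EuclideanSpace ℝ (Fin d)))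
    (x : EuclideanSpace ℝ (Fin d)) : Prop :=
  LocallyIntegrable (fun y => 1 / ‖x - y‖ ^ s) μ

/-- `⟨T δ_x, φ⟩_μ = ∫ K(y - x) φ(y) dμ(y)`. -/
def pairDirac (K : EuclideanSpace ℝ (Fin d) → EuclideanSpace ℂ (Fin d'))
    (μ : Measure (EuclideanSpace ℝ (Fin d))) (x : EuclideanSpace ℝ (Fin d))
    (φ : EuclideanSpace ℝ (Fin d) → ℝ) : EuclideanSpace ℂ (Fin d') :=
  ∫ y, φ y • K (y - x) ∂μ

/-- `H_{f,φ}(x,y) = (f(y) φ(x) - f(x) φ(y)) / 2`. -/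
def antisym (f φ : EuclideanSpace ℝ (Fin d) → ℝ) (x y : EuclideanSpace ℝ (Fin d)) : ℝ :=
  (f y * φ x - f x * φ y) / 2

/-- `⟨T(fμ), φ⟩_μ = ∬ K(x - y) H_{f,φ}(x,y) dμ(x) dμ(y)` for `f, φ ∈ Lip_0`. -/
def pairSmooth (K : EuclideanSpace ℝ (Fin d) → EuclideanSpace ℂ (Fin d'))
    (μ : Measure (EuclideanSpace ℝ (Fin d)))
    (f φ : EuclideanSpace ℝ (Fin d) → ℝ) : EuclideanSpace ℂ (Fin d') :=
  ∫ p : EuclideanSpace ℝ (Fin d) × EuclideanSpace ℝ (Fin d),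
    antisym f φ p.1 p.2 • K (p.1 - p.2) ∂(μ.prod μ)

/-- A sequence of Lipschitz cutoffs with `0 ≤ ψ_k ≤ 1`, `ψ_k = 1` on `B(0,k)` and `ψ_k = 0` off
`B(0,k+1)`. -/
def cutoff (k : ℕ) (y : EuclideanSpace ℝ (Fin d)) : ℝ :=
  max 0 (min 1 ((k : ℝ) + 1 - ‖y‖))

/-- `T̄_μ(φ)(x) = ⟨T(δ_x - ημ), φ⟩_μ = lim_k ⟨T(δ_x - ημ), ψ_k φ⟩_μ`, for bounded Lipschitz `φ` and
`x` with `δ_x ∈ 𝔐_bounded(μ)`.  For nice `μ` and a Calderón–Zygmund kernel `K` all the integrals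
converge absolutely, the limit exists, and it does not depend on the choice of the cutoffs. -/
def Tbar (K : EuclideanSpace ℝ (Fin d) → EuclideanSpace ℂ (Fin d'))
    (μ : Measure (EuclideanSpace ℝ (Fin d))) (η φ : EuclideanSpace ℝ (Fin d) → ℝ)
    (x : EuclideanSpace ℝ (Fin d)) : EuclideanSpace ℂ (Fin d') :=
  limUnder atTop (fun k : ℕ =>
    pairDirac K μ x (fun y => cutoff k y * φ y) - pairSmooth K μ η (fun y => cutoff k y * φ y))

end

end WienerCZ

/-! Formally, `T̄_μ(1)` being constant says that the convolution of `μ` with the kernel is constant,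
so that the product of `m(ξ/|ξ|)/|ξ|^{d-s}` with the Fourier transform of `μ` vanishes off the
origin. Since `m` has no zeros, `μ` itself then has spectrum in `{0}`. A nonzero positive measure of
growth `r^s` with `s < d` cannot have such a spectrum. The proof runs this argument by duality and
never forms the Fourier transform of `μ`.

Regularization: `K (y - x)` need not be `μ`-integrable at infinity, but `kernelDiff K x y` is
`O(|y|^{-s-1})` there, and `T̄_μ(1)(x)` differs from its `μ`-integral by a constant
(`exists_Tbar_eq`). Integrating in `x` against a Schwartz `f` of mean zero removes the constants and
the correction term, which leaves `∫ (f ⋆ K) dμ = 0` (`integral_smul_kernel_eq_zero`).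

Division: write `κ` for `homogeneousMultiplier s m`. It is smooth off the origin
(`contDiffAt_homogeneousMultiplier`) and has no zeros there. For `φ ∈ C_c^∞` supported off the
origin, the functions with Fourier transform `conj(κ_j) φ / |κ|²` are therefore Schwartz of mean
zero. The `j`-th components of their convolutions with `K` add up to `𝓕⁻ φ`, so `∫ 𝓕⁻ φ dμ = 0`.

Low frequencies: cutting `φ` off to `|ξ| ≲ 1/r` leaves a piece whose inverse transform has
`μ`-integral `O(r^{s-d})`, which tends to `0` as `r → ∞`. So the support condition on `φ` can be
dropped (`IsNice.integral_fourierInv_eq_zero`). Testing with a translated nonnegative `𝓕⁻ φ` that is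
positive at a prescribed point then gives `μ = 0`. -/

namespace WienerCZ

/-! ### Integrals of power weights against measures of growth `r^s`. -/

section Growth

variable {X : Type*} [PseudoMetricSpace X] [MeasurableSpace X] [OpensMeasurableSpace X]

/-- Dyadic decomposition around `x`: the shell at distance about `2^{-k}` contributes at most a
constant times `2^{kβ} 2^{-ks}`, a geometric series because `β < s`. -/
theorem exists_lintegral_ball_rpow_neg_le {ν : Measure X} {s Λ β : ℝ} (hβ : 0 ≤ β) (hβs : β < s)
    (hν : ∀ x, ∀ r : ℝ, 0 < r → ν (ball x r) ≤ ENNReal.ofReal (Λ * r ^ s)) :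
    ∃ C : ℝ≥0, ∀ x, ∫⁻ y in ball x 1, ENNReal.ofReal (dist y x ^ (-β)) ∂ν ≤ C := by
  have hq0 : 0 < (2 : ℝ) ^ (β - s) := by positivity
  have hq1 : (2 : ℝ) ^ (β - s) < 1 := Real.rpow_lt_one_of_one_lt_of_neg one_lt_two (by linarith)
  have hsum : ∑' k : ℕ, ENNReal.ofReal (2 ^ β * |Λ| * ((2 : ℝ) ^ (β - s)) ^ k) ≠ ⊤ :=
    ((summable_geometric_of_lt_one hq0.le hq1).mul_left _).tsum_ofReal_ne_top
  refine ⟨(∑' k : ℕ, ENNReal.ofReal (2 ^ β * |Λ| * ((2 : ℝ) ^ (β - s)) ^ k)).toNNReal, fun x => ?_⟩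
  rw [ENNReal.coe_toNNReal hsum]
  calc ∫⁻ y in ball x 1, ENNReal.ofReal (dist y x ^ (-β)) ∂ν
      ≤ ∫⁻ y in ball x 1, ∑' k : ℕ, (ball x ((1 / 2 : ℝ) ^ k)).indicator
          (fun _ => ENNReal.ofReal (2 ^ ((k + 1 : ℝ) * β))) y ∂ν := by
        refine setLIntegral_mono' measurableSet_ball fun y hy => ?_
        rw [mem_ball] at hy
        rcases (dist_nonneg (x := y) (y := x)).eq_or_lt with h0 | h0
        -- At the centre the real power `0 ^ (-β)` is `0` or `1`, so the term `k = 0` dominates it.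
        · refine le_trans ?_ (ENNReal.le_tsum 0)
          rw [Set.indicator_of_mem (by simp [← h0])]
          refine ENNReal.ofReal_le_ofReal ?_
          rw [← h0]
          refine (Real.zero_rpow_le_one _).trans (Real.one_le_rpow one_le_two (by simpa))
        · obtain ⟨k, hk1, hk2⟩ := exists_nat_pow_near_of_lt_one h0 hy.le
            (by norm_num : (0 : ℝ) < 1 / 2) (by norm_num)
          rcases hk2.lt_or_eq with hk2 | hk2
          · refine le_trans ?_ (ENNReal.le_tsum k)
            rw [Set.indicator_of_mem (by simpa using hk2)]
            refine ENNReal.ofReal_le_ofReal ?_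
            calc dist y x ^ (-β) ≤ ((1 / 2 : ℝ) ^ (k + 1)) ^ (-β) :=
                  Real.rpow_le_rpow_of_nonpos (by positivity) hk1.le (by linarith)
              _ = 2 ^ ((k + 1 : ℝ) * β) := by
                  rw [one_div, inv_pow, Real.inv_rpow (by positivity), Real.rpow_neg (by positivity),
                    inv_inv, ← Real.rpow_natCast, ← Real.rpow_mul (by norm_num)]
                  push_cast; rfl
          -- A point at distance exactly `2^{-k}` lies outside the open ball of index `k`, so the
          -- term of index `k - 1` is used; the factor `2^{(k+1)β}` in the series leaves room for
          -- this.
          · have hk0 : k ≠ 0 := by rintro rfl; simp at hk2; linarith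
            obtain ⟨j, rfl⟩ := Nat.exists_eq_succ_of_ne_zero hk0
            refine le_trans ?_ (ENNReal.le_tsum j)
            rw [Set.indicator_of_mem]
            · refine ENNReal.ofReal_le_ofReal (le_of_eq ?_)
              rw [hk2, one_div, inv_pow, Real.inv_rpow (by positivity), Real.rpow_neg (by positivity),
                    inv_inv, ← Real.rpow_natCast, ← Real.rpow_mul (by norm_num)]
              push_cast; rfl
            · rw [mem_ball, hk2]
              exact pow_lt_pow_right_of_lt_one₀ (by norm_num) (by norm_num) (Nat.lt_succ_self j)
    _ ≤ ∫⁻ y, ∑' k : ℕ, (ball x ((1 / 2 : ℝ) ^ k)).indicator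
          (fun _ => ENNReal.ofReal (2 ^ ((k + 1 : ℝ) * β))) y ∂ν := setLIntegral_le_lintegral _ _
    _ = ∑' k : ℕ, ENNReal.ofReal (2 ^ ((k + 1 : ℝ) * β)) * ν (ball x ((1 / 2 : ℝ) ^ k)) := by
        rw [lintegral_tsum fun k => (measurable_const.indicator measurableSet_ball).aemeasurable]
        simp_rw [lintegral_indicator_const measurableSet_ball]
    _ ≤ ∑' k : ℕ, ENNReal.ofReal (2 ^ β * |Λ| * ((2 : ℝ) ^ (β - s)) ^ k) := by
        refine ENNReal.tsum_le_tsum fun k => ?_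
        calc _ ≤ ENNReal.ofReal (2 ^ ((k + 1 : ℝ) * β)) *
              ENNReal.ofReal (|Λ| * ((1 / 2 : ℝ) ^ k) ^ s) := by
              gcongr
              refine (hν _ _ (by positivity)).trans (ENNReal.ofReal_le_ofReal ?_)
              gcongr
              exact le_abs_self Λ
          _ = _ := by
              rw [← ENNReal.ofReal_mul (by positivity)]
              congr 1
              have h1 : ((1 / 2 : ℝ) ^ k) ^ s = 2 ^ (-(k * s)) := by
                rw [one_div, inv_pow, Real.inv_rpow (by positivity), ← Real.rpow_natCast,
                  ← Real.rpow_mul (by norm_num), Real.rpow_neg (by norm_num)]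
              have h2 : ((2 : ℝ) ^ (β - s)) ^ k = 2 ^ (k * β) * 2 ^ (-(k * s)) := by
                rw [← Real.rpow_natCast, ← Real.rpow_mul (by norm_num),
                  ← Real.rpow_add (by norm_num)]
                congr 1; ring
              have h3 : (2 : ℝ) ^ ((k + 1 : ℝ) * β) = 2 ^ (k * β) * 2 ^ β := by
                rw [← Real.rpow_add (by norm_num)]; congr 1; ring
              rw [h1, h2, h3]; ring

/-- Dyadic shells at scale `R`, going outwards; the series converges since `p > s`. Uniformity in
`R` matters later, when `R → ∞` in the low-frequency estimate. -/
theorem exists_lintegral_one_add_dist_div_rpow_neg_le {ν : Measure X} {s Λ p : ℝ} (hs : 0 ≤ s)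
    (hp : s < p) (hν : ∀ x, ∀ r : ℝ, 0 < r → ν (ball x r) ≤ ENNReal.ofReal (Λ * r ^ s)) :
    ∃ C : ℝ≥0, ∀ x, ∀ R : ℝ, 0 < R →
      ∫⁻ y, ENNReal.ofReal ((1 + dist y x / R) ^ (-p)) ∂ν ≤ C * ENNReal.ofReal (R ^ s) := by
  have hq0 : 0 < (2 : ℝ) ^ (s - p) := by positivity
  have hq1 : (2 : ℝ) ^ (s - p) < 1 := Real.rpow_lt_one_of_one_lt_of_neg one_lt_two (by linarith)
  have hsum : ∑' k : ℕ, ENNReal.ofReal (2 ^ s * |Λ| * ((2 : ℝ) ^ (s - p)) ^ k) ≠ ⊤ :=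
    ((summable_geometric_of_lt_one hq0.le hq1).mul_left _).tsum_ofReal_ne_top
  refine ⟨(∑' k : ℕ, ENNReal.ofReal (2 ^ s * |Λ| * ((2 : ℝ) ^ (s - p)) ^ k)).toNNReal,
    fun x R hR => ?_⟩
  rw [ENNReal.coe_toNNReal hsum]
  calc ∫⁻ y, ENNReal.ofReal ((1 + dist y x / R) ^ (-p)) ∂ν
      ≤ ∫⁻ y, ∑' k : ℕ, (ball x (2 ^ (k + 1) * R)).indicator
          (fun _ => ENNReal.ofReal (2 ^ (-(k * p)))) y ∂ν := by
        refine lintegral_mono fun y => ?_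
        have h1 : 1 ≤ 1 + dist y x / R := by
          have : 0 ≤ dist y x / R := by positivity
          linarith
        obtain ⟨k, hk1, hk2⟩ := exists_nat_pow_near h1 one_lt_two
        refine le_trans ?_ (ENNReal.le_tsum k)
        rw [Set.indicator_of_mem]
        · refine ENNReal.ofReal_le_ofReal ?_
          calc (1 + dist y x / R) ^ (-p) ≤ (2 ^ k : ℝ) ^ (-p) :=
                Real.rpow_le_rpow_of_nonpos (by positivity) hk1 (by linarith)
            _ = _ := by
                rw [← Real.rpow_natCast, ← Real.rpow_mul (by norm_num)]
                congr 1; ring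
        · rw [mem_ball, ← div_lt_iff₀ hR]
          linarith
    _ = ∑' k : ℕ, ENNReal.ofReal (2 ^ (-(k * p))) * ν (ball x (2 ^ (k + 1) * R)) := by
        rw [lintegral_tsum fun k => (measurable_const.indicator measurableSet_ball).aemeasurable]
        simp_rw [lintegral_indicator_const measurableSet_ball]
    _ ≤ ∑' k : ℕ, ENNReal.ofReal (2 ^ s * |Λ| * ((2 : ℝ) ^ (s - p)) ^ k) *
          ENNReal.ofReal (R ^ s) := by
        refine ENNReal.tsum_le_tsum fun k => ?_
        calc _ ≤ ENNReal.ofReal (2 ^ (-(k * p))) *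
              ENNReal.ofReal (|Λ| * (2 ^ (k + 1) * R) ^ s) := by
              gcongr
              refine (hν _ _ (by positivity)).trans (ENNReal.ofReal_le_ofReal ?_)
              gcongr
              exact le_abs_self Λ
          _ = _ := by
              rw [← ENNReal.ofReal_mul (by positivity), ← ENNReal.ofReal_mul (by positivity)]
              congr 1
              have h1 : ((2 : ℝ) ^ (k + 1) * R) ^ s = 2 ^ (k * s) * 2 ^ s * R ^ s := by
                rw [Real.mul_rpow (by positivity) hR.le, ← Real.rpow_natCast,
                  ← Real.rpow_mul (by norm_num), ← Real.rpow_add (by norm_num)]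
                push_cast
                ring_nf
              have h2 : ((2 : ℝ) ^ (s - p)) ^ k = 2 ^ (-(k * p)) * 2 ^ (k * s) := by
                rw [← Real.rpow_natCast, ← Real.rpow_mul (by norm_num),
                  ← Real.rpow_add (by norm_num)]
                congr 1; ring
              rw [h1, h2]; ring
    _ = _ := ENNReal.tsum_mul_right

end Growth

section Lebesgue

variable {V : Type*} [NormedAddCommGroup V] [InnerProductSpace ℝ V] [FiniteDimensional ℝ V]
  [MeasurableSpace V] [BorelSpace V]

/-- Away from `y` the singular factor is at most `1`. Near `y` the weight is at most `1`, and the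
dyadic bound applies to Lebesgue measure, whose growth exponent exceeds `s`. -/
theorem exists_lintegral_one_add_norm_mul_le {s : ℝ} (hs : 0 ≤ s)
    (hsd : s < Module.finrank ℝ V) :
    ∃ C : ℝ≥0, ∀ y : V, ∫⁻ x : V, ENNReal.ofReal ((1 + ‖x‖) ^ (-(Module.finrank ℝ V + 1 : ℝ)) *
      (1 + dist x y ^ (-s))) ≤ C := by
  have hvol : ∀ x : V, ∀ r : ℝ, 0 < r → volume (ball x r) ≤
      ENNReal.ofReal ((volume (ball (0 : V) 1)).toReal * r ^ (Module.finrank ℝ V : ℝ)) := by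
    intro x r hr
    rw [Measure.addHaar_ball_of_pos _ _ hr, Real.rpow_natCast,
      ENNReal.ofReal_mul ENNReal.toReal_nonneg,
      ENNReal.ofReal_toReal measure_ball_lt_top.ne, mul_comm]
  obtain ⟨C, hC⟩ := exists_lintegral_ball_rpow_neg_le hs hsd hvol
  have hI : ∫⁻ x : V, ENNReal.ofReal ((1 + ‖x‖) ^ (-(Module.finrank ℝ V + 1 : ℝ))) < ⊤ :=
    finite_integral_one_add_norm (by linarith)
  set I := ∫⁻ x : V, ENNReal.ofReal ((1 + ‖x‖) ^ (-(Module.finrank ℝ V + 1 : ℝ))) with hIdef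
  refine ⟨2 * I.toNNReal + C, fun y => ?_⟩
  push_cast
  rw [ENNReal.coe_toNNReal hI.ne]
  have hle : ∀ x : V, (1 + ‖x‖) ^ (-(Module.finrank ℝ V + 1 : ℝ)) ≤ 1 := fun x =>
    Real.rpow_le_one_of_one_le_of_nonpos (by linarith [norm_nonneg x])
      (by have : (0 : ℝ) ≤ Module.finrank ℝ V := by positivity
          linarith)
  calc ∫⁻ x : V, ENNReal.ofReal ((1 + ‖x‖) ^ (-(Module.finrank ℝ V + 1 : ℝ)) *
        (1 + dist x y ^ (-s)))
      ≤ ∫⁻ x : V, (2 * ENNReal.ofReal ((1 + ‖x‖) ^ (-(Module.finrank ℝ V + 1 : ℝ))) +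
        (ball y 1).indicator (fun x => ENNReal.ofReal (dist x y ^ (-s))) x) := by
        refine lintegral_mono fun x => ?_
        have h0 : 0 ≤ (1 + ‖x‖) ^ (-(Module.finrank ℝ V + 1 : ℝ)) := by positivity
        have h1 : 0 ≤ dist x y ^ (-s) := by positivity
        by_cases hx : x ∈ ball y 1
        · rw [Set.indicator_of_mem hx, mul_add, mul_one, ENNReal.ofReal_add h0 (by positivity)]
          gcongr
          · exact le_mul_of_one_le_left' one_le_two
          · exact mul_le_of_le_one_left h1 (hle x)
        · rw [Set.indicator_of_notMem hx, add_zero, ← ENNReal.ofReal_ofNat 2,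
            ← ENNReal.ofReal_mul zero_le_two, mul_comm]
          refine ENNReal.ofReal_le_ofReal (mul_le_mul_of_nonneg_right ?_ h0)
          have : dist x y ^ (-s) ≤ 1 := Real.rpow_le_one_of_one_le_of_nonpos
            (by simpa using hx) (by linarith)
          linarith
    _ ≤ 2 * I + C := by
        rw [lintegral_add_left (by fun_prop), lintegral_const_mul _ (by fun_prop),
          lintegral_indicator measurableSet_ball]
        gcongr
        exact hC y

end Lebesgue

end WienerCZ

/-! ### Smooth kernels and the decay of the regularized kernel. -/

namespace WienerCZ

/-- A kernel on `V`, normalized by `K 0 = 0`, that is odd, homogeneous of order `-s`, bounded by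
`|x|^{-s}` and smooth away from the origin. -/
structure IsSmoothKernel {V E : Type*} [NormedAddCommGroup V] [NormedSpace ℝ V]
    [NormedAddCommGroup E] [NormedSpace ℝ E] (s : ℝ) (K : V → E) : Prop where
  zero : K 0 = 0
  odd : ∀ x, K (-x) = -K x
  hom : ∀ x, ∀ t : ℝ, 0 < t → K (t • x) = t ^ (-s) • K x
  bound : ∀ x, ‖K x‖ ≤ ‖x‖ ^ (-s)
  smooth : ContDiffOn ℝ ∞ K {0}ᶜ

/-- The function `K (y - x) - 1_{|y| ≥ 1} K y`. -/
noncomputable def kernelDiff {V E : Type*} [NormedAddCommGroup V] [NormedAddCommGroup E]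
    (K : V → E) (x y : V) : E :=
  K (y - x) - {y : V | 1 ≤ ‖y‖}.indicator K y

section Smooth

variable {d : ℕ} {E : Type*} [NormedAddCommGroup E] [NormedSpace ℝ E]

/-- `F` is `Ω` composed with the radial projection. Smoothness of a map into the sphere is available
for globally defined maps, so the projection is precomposed with a map that is the identity near
`x₀` and avoids the origin everywhere. -/
theorem contDiffAt_of_contMDiff_sphere {n : ℕ}
    [Fact (Module.finrank ℝ (EuclideanSpace ℝ (Fin d)) = n + 1)]
    {Ω : sphere (0 : EuclideanSpace ℝ (Fin d)) 1 → E}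
    (hΩ : ContMDiff (𝓡 n) 𝓘(ℝ, E) ∞ Ω) {F : EuclideanSpace ℝ (Fin d) → E}
    (hF : ∀ x (hx : x ≠ 0), F x = Ω (toSphere x hx)) {x₀ : EuclideanSpace ℝ (Fin d)}
    (hx₀ : x₀ ≠ 0) : ContDiffAt ℝ ∞ F x₀ := by
  have hpos : 0 < ‖x₀‖ := norm_pos_iff.mpr hx₀
  let b : ContDiffBump x₀ := ⟨‖x₀‖ / 4, ‖x₀‖ / 2, by linarith, by linarith⟩
  let p : EuclideanSpace ℝ (Fin d) → EuclideanSpace ℝ (Fin d) := fun x => x₀ + b x • (x - x₀)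
  have hp : ContDiff ℝ ∞ p := by
    have hb : ContDiff ℝ ∞ b := b.contDiff
    exact contDiff_const.add (hb.smul (contDiff_id.sub contDiff_const))
  -- `p` stays within distance `‖x₀‖ / 2` of `x₀`.
  have hp0 : ∀ x, p x ≠ 0 := by
    intro x h
    have h1 : b x • (x - x₀) = -x₀ := by
      rw [eq_neg_iff_add_eq_zero, add_comm]; exact h
    have h2 : ‖b x • (x - x₀)‖ = ‖x₀‖ := by rw [h1, norm_neg]
    by_cases hx : x ∈ ball x₀ (‖x₀‖ / 2)
    · rw [norm_smul, Real.norm_of_nonneg b.nonneg] at h2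
      rw [mem_ball, dist_eq_norm] at hx
      have := mul_le_mul_of_nonneg_right (b.le_one (x := x)) (norm_nonneg (x - x₀))
      linarith
    · rw [b.zero_of_le_dist (by simpa using hx), zero_smul, norm_zero] at h2
      linarith
  have hg : ContDiff ℝ ∞ fun x => ‖p x‖⁻¹ • p x :=
    ((hp.norm ℝ hp0).inv fun x => norm_ne_zero_iff.mpr (hp0 x)).smul hp
  have hcomp := hΩ.comp (hg.contMDiff.codRestrict_sphere fun x => (toSphere (p x) (hp0 x)).2)
  refine (hcomp.contDiff.contDiffAt (x := x₀)).congr_of_eventuallyEq ?_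
  filter_upwards [b.eventuallyEq_one, isOpen_ne.mem_nhds hx₀] with x hx hx0
  have hpx : p x = x := by simp [p, hx]
  rw [hF x hx0]
  simp only [Function.comp]
  congr 1
  ext1
  change ‖x‖⁻¹ • x = ‖p x‖⁻¹ • p x
  rw [hpx]

end Smooth

section Bounds

variable {V E : Type*} [NormedAddCommGroup V] [InnerProductSpace ℝ V] [FiniteDimensional ℝ V]
  [NormedAddCommGroup E] [NormedSpace ℝ E] {s : ℝ} {K : V → E}

omit [FiniteDimensional ℝ V] in
theorem IsSmoothKernel.continuousOn (hK : IsSmoothKernel s K) : ContinuousOn K {0}ᶜ :=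
  hK.smooth.continuousOn

/-- Mean value inequality for `‖y‖ = 1`, where the segment stays in the annulus `1/2 ≤ |z| ≤ 2` and
`C` bounds the derivative; homogeneity gives the other `y`. -/
theorem IsSmoothKernel.exists_norm_sub_le (hK : IsSmoothKernel s K) :
    ∃ C : ℝ, 0 ≤ C ∧ ∀ x y : V, 2 * ‖x‖ ≤ ‖y‖ → 0 < ‖y‖ →
      ‖K (y - x) - K y‖ ≤ C * ‖x‖ * ‖y‖ ^ (-(s + 1)) := by
  have hcpt : IsCompact (closedBall (0 : V) 2 \ ball 0 (1 / 2)) :=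
    (isCompact_closedBall _ _).diff isOpen_ball
  have hsub : closedBall (0 : V) 2 \ ball 0 (1 / 2) ⊆ {0}ᶜ := by
    rintro x ⟨-, hx⟩ rfl
    simp at hx
  have hcont : ContinuousOn (fderiv ℝ K) {0}ᶜ :=
    hK.smooth.continuousOn_fderiv_of_isOpen isOpen_compl_singleton (by simp)
  obtain ⟨C, hC⟩ := hcpt.exists_bound_of_continuousOn (hcont.mono hsub)
  have hC0 : 0 ≤ max C 0 := le_max_right _ _
  have unit : ∀ x y : V, ‖y‖ = 1 → ‖x‖ ≤ 1 / 2 → ‖K (y - x) - K y‖ ≤ max C 0 * ‖x‖ := by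
    intro x y hy hx
    have hin : closedBall y (1 / 2) ⊆ closedBall (0 : V) 2 \ ball 0 (1 / 2) := by
      intro z hz
      rw [mem_closedBall, dist_eq_norm] at hz
      have h1 := norm_sub_norm_le y z
      have h2 := norm_sub_norm_le z y
      rw [norm_sub_rev] at h1
      refine ⟨by simp; linarith, by simp; linarith⟩
    have := (convex_closedBall y (1 / 2)).norm_image_sub_le_of_norm_fderiv_le (𝕜 := ℝ) (f := K)
      (C := max C 0) (x := y) (y := y - x)
      (fun z hz => (hK.smooth.differentiableOn (by simp)).differentiableAt
        (isOpen_compl_singleton.mem_nhds (hsub (hin hz))))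
      (fun z hz => (hC z (hin hz)).trans (le_max_left _ _)) (by simp) (by simpa using hx)
    simpa using this
  refine ⟨max C 0, hC0, fun x y hxy hy => ?_⟩
  have hu := unit (‖y‖⁻¹ • x) (‖y‖⁻¹ • y) (by rw [norm_smul, norm_inv, norm_norm, inv_mul_cancel₀ hy.ne'])
    (by rw [norm_smul, norm_inv, norm_norm, inv_mul_le_iff₀ hy]; linarith)
  rw [← smul_sub, hK.hom _ _ (inv_pos.mpr hy), hK.hom _ _ (inv_pos.mpr hy), ← smul_sub, norm_smul,
    norm_smul, norm_inv, norm_norm, Real.norm_of_nonneg (by positivity), Real.inv_rpow hy.le,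
    Real.rpow_neg hy.le, inv_inv] at hu
  have hps : 0 < ‖y‖ ^ s := by positivity
  rw [neg_add, Real.rpow_add hy, Real.rpow_neg hy.le, Real.rpow_neg_one]
  rw [← le_div_iff₀' hps] at hu
  refine hu.trans (le_of_eq ?_)
  field_simp

/-- If `‖y‖ ≤ 2‖x‖ + 2`, size bounds suffice, since `1 + ‖y‖ ≤ 3 (1 + ‖x‖)` makes the product of the
two weights bounded below. For larger `‖y‖` the cancellation gains a power of `‖y‖`, and
`‖y‖^{-(s+1)}` is integrable against a measure of growth `r^s`. -/
theorem IsSmoothKernel.exists_norm_kernelDiff_le (hs : 0 ≤ s) (hK : IsSmoothKernel s K) :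
    ∃ C : ℝ, 0 ≤ C ∧ ∀ x y : V, ‖kernelDiff K x y‖ ≤
      C * ((1 + ‖x‖) ^ (s + 1) * (1 + ‖y‖) ^ (-(s + 1)) * (1 + dist x y ^ (-s))) := by
  obtain ⟨C, hC0, hC⟩ := hK.exists_norm_sub_le
  have hs1 : 0 ≤ s + 1 := by linarith
  refine ⟨3 ^ (s + 1) + C * 2 ^ (s + 1), by positivity, fun x y => ?_⟩
  have hx : (1 : ℝ) ≤ 1 + ‖x‖ := by linarith [norm_nonneg x]
  have hy : (0 : ℝ) < 1 + ‖y‖ := by linarith [norm_nonneg y]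
  have hd0 : 0 ≤ dist x y ^ (-s) := by positivity
  rcases le_or_gt ‖y‖ (2 * ‖x‖ + 2) with h | h
  · have h1 : ‖kernelDiff K x y‖ ≤ 1 + dist x y ^ (-s) := by
      have ha : ‖K (y - x)‖ ≤ dist x y ^ (-s) := by
        rw [dist_comm, dist_eq_norm]; exact hK.bound _
      have hb : ‖{y : V | 1 ≤ ‖y‖}.indicator K y‖ ≤ 1 := by
        by_cases hy1 : 1 ≤ ‖y‖
        · rw [Set.indicator_of_mem (by exact hy1)]
          exact (hK.bound y).trans (Real.rpow_le_one_of_one_le_of_nonpos hy1 (by linarith))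
        · rw [Set.indicator_of_notMem (by exact hy1)]; simp
      calc _ ≤ _ := norm_sub_le _ _
        _ ≤ _ := by linarith
    have h2 : 1 ≤ 3 ^ (s + 1) * ((1 + ‖x‖) ^ (s + 1) * (1 + ‖y‖) ^ (-(s + 1))) := by
      rw [Real.rpow_neg hy.le, ← mul_assoc, ← Real.mul_rpow (by norm_num) (by linarith),
        ← div_eq_mul_inv, one_le_div (by positivity)]
      exact Real.rpow_le_rpow hy.le (by linarith) hs1
    calc ‖kernelDiff K x y‖ ≤ 1 * (1 + dist x y ^ (-s)) := by rwa [one_mul]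
      _ ≤ (3 ^ (s + 1) * ((1 + ‖x‖) ^ (s + 1) * (1 + ‖y‖) ^ (-(s + 1)))) *
          (1 + dist x y ^ (-s)) := by gcongr
      _ = 3 ^ (s + 1) * ((1 + ‖x‖) ^ (s + 1) * (1 + ‖y‖) ^ (-(s + 1)) *
          (1 + dist x y ^ (-s))) := by ring
      _ ≤ _ := by gcongr; simp; positivity
  · have hx0 := norm_nonneg x
    have hy1 : 1 ≤ ‖y‖ := by linarith
    have h1 : ‖kernelDiff K x y‖ ≤ C * ‖x‖ * ‖y‖ ^ (-(s + 1)) := by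
      rw [kernelDiff, Set.indicator_of_mem (by exact hy1)]
      exact hC x y (by linarith) (by linarith)
    have h2 : ‖y‖ ^ (-(s + 1)) ≤ 2 ^ (s + 1) * (1 + ‖y‖) ^ (-(s + 1)) := by
      rw [Real.rpow_neg (norm_nonneg y), Real.rpow_neg hy.le, ← div_eq_mul_inv,
        inv_le_comm₀ (by positivity) (by positivity), inv_div, div_le_iff₀ (by positivity),
        mul_comm, ← Real.mul_rpow (by norm_num) (by positivity)]
      exact Real.rpow_le_rpow hy.le (by linarith) hs1
    have h3 : ‖x‖ ≤ (1 + ‖x‖) ^ (s + 1) := by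
      calc ‖x‖ ≤ (1 + ‖x‖) ^ (1 : ℝ) := by rw [Real.rpow_one]; linarith
        _ ≤ _ := Real.rpow_le_rpow_of_exponent_le hx (by linarith)
    calc ‖kernelDiff K x y‖ ≤ C * ‖x‖ * ‖y‖ ^ (-(s + 1)) := h1
      _ ≤ C * (1 + ‖x‖) ^ (s + 1) * (2 ^ (s + 1) * (1 + ‖y‖) ^ (-(s + 1))) := by gcongr
      _ = C * 2 ^ (s + 1) * ((1 + ‖x‖) ^ (s + 1) * (1 + ‖y‖) ^ (-(s + 1)) * 1) := by ring
      _ ≤ (3 ^ (s + 1) + C * 2 ^ (s + 1)) * ((1 + ‖x‖) ^ (s + 1) * (1 + ‖y‖) ^ (-(s + 1)) *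
          (1 + dist x y ^ (-s))) := by
        gcongr
        · have : (0 : ℝ) ≤ 3 ^ (s + 1) := by positivity
          linarith
        · linarith

variable [MeasurableSpace V] [BorelSpace V] [MeasurableSpace E] [BorelSpace E]

omit [FiniteDimensional ℝ V] in
theorem IsSmoothKernel.measurable (hK : IsSmoothKernel s K) : Measurable K :=
  measurable_of_continuousOn_compl_singleton 0 hK.continuousOn

end Bounds

section Normalize

variable {d d' : ℕ}

/-- Off the origin `K` is `‖x‖^{-s}` times the radial extension of its angular part. The value at
`0` is arbitrary and is reset to `0`. -/
theorem IsCZKernel.isSmoothKernel_indicator {s : ℝ} (hd : 2 ≤ d)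
    {K : EuclideanSpace ℝ (Fin d) → EuclideanSpace ℂ (Fin d')}
    (hK : IsCZKernel s K) (hKhom : IsHomogeneousKernel s K)
    (hKsmooth : SmoothOnSphere hd (angularPart K)) :
    IsSmoothKernel s (({0}ᶜ : Set (EuclideanSpace ℝ (Fin d))).indicator K) := by
  have hne : ∀ x : EuclideanSpace ℝ (Fin d), x ≠ 0 →
      ({0}ᶜ : Set (EuclideanSpace ℝ (Fin d))).indicator K x = K x := fun x hx =>
    Set.indicator_of_mem (by simpa using hx) _
  have h0 : ({0}ᶜ : Set (EuclideanSpace ℝ (Fin d))).indicator K 0 = 0 := by simp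
  refine ⟨h0, fun x => ?_, fun x t ht => ?_, fun x => ?_, ?_⟩
  · rcases eq_or_ne x 0 with rfl | hx
    · simp
    · rw [hne x hx, hne _ (neg_ne_zero.mpr hx), hK.odd x hx]
  · rcases eq_or_ne x 0 with rfl | hx
    · simp
    · rw [hne x hx, hne _ (smul_ne_zero ht.ne' hx), hKhom x hx t ht]
  · rcases eq_or_ne x 0 with rfl | hx
    · rw [h0, norm_zero]; positivity
    · rw [hne x hx, Real.rpow_neg (norm_nonneg x), ← one_div]
      exact hK.bound x hx
  · have : Fact (Module.finrank ℝ (EuclideanSpace ℝ (Fin d)) = (d - 1) + 1) :=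
      ⟨by rw [finrank_euclideanSpace_fin]; omega⟩
    intro x hx
    rw [Set.mem_compl_singleton_iff] at hx
    refine ContDiffAt.contDiffWithinAt ?_
    have h1 : ContDiffAt ℝ ∞ (fun x => ‖x‖ ^ s • K x) x := by
      refine contDiffAt_of_contMDiff_sphere (n := d - 1) hKsmooth (fun y hy => ?_) hx
      simp only [angularPart, toSphere]
      rw [hKhom y hy _ (inv_pos.mpr (norm_pos_iff.mpr hy)), Real.inv_rpow (norm_nonneg y),
        Real.rpow_neg (norm_nonneg y), inv_inv]
    have h2 : ContDiffAt ℝ ∞ (fun x : EuclideanSpace ℝ (Fin d) => ‖x‖ ^ (-s)) x :=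
      (contDiffAt_norm ℝ hx).rpow_const_of_ne (norm_ne_zero_iff.mpr hx)
    refine (h2.smul h1).congr_of_eventuallyEq ?_
    filter_upwards [isOpen_ne.mem_nhds hx] with y hy
    have hy' : 0 < ‖y‖ := norm_pos_iff.mpr hy
    rw [hne y hy, Pi.smul_apply', smul_smul, ← Real.rpow_add hy', neg_add_cancel, Real.rpow_zero, one_smul]

end Normalize

end WienerCZ

/-! ### Integrability of the regularized kernel; cutoffs. -/

namespace WienerCZ

variable {d d' : ℕ} {s Λ : ℝ} {μ : Measure (EuclideanSpace ℝ (Fin d))}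
  {K : EuclideanSpace ℝ (Fin d) → EuclideanSpace ℂ (Fin d')}

theorem exists_norm_le_one_add_norm_rpow {V F : Type*} [NormedAddCommGroup V] [NormedSpace ℝ V]
    [NormedAddCommGroup F] [NormedSpace ℝ F] (f : 𝓢(V, F)) (p : ℝ) :
    ∃ C : ℝ, 0 ≤ C ∧ ∀ x, ‖f x‖ ≤ C * (1 + ‖x‖) ^ (-p) := by
  obtain ⟨k, hk⟩ := exists_nat_ge p
  refine ⟨2 ^ k * (Finset.Iic (k, 0)).sup (fun m => SchwartzMap.seminorm ℝ m.1 m.2) f,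
    mul_nonneg (by positivity) (apply_nonneg _ _), fun x => ?_⟩
  have h := f.one_add_le_sup_seminorm_apply (𝕜 := ℝ) (m := (k, 0)) le_rfl le_rfl x
  rw [norm_iteratedFDeriv_zero] at h
  have h1 : (1 : ℝ) ≤ 1 + ‖x‖ := by linarith [norm_nonneg x]
  refine ((le_div_iff₀' (by positivity)).mpr h).trans ?_
  rw [div_eq_mul_inv, Real.rpow_neg (by positivity)]
  refine mul_le_mul_of_nonneg_left (inv_anti₀ (by positivity) ?_)
    (mul_nonneg (by positivity) (apply_nonneg _ _))
  rw [← Real.rpow_natCast]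
  exact Real.rpow_le_rpow_of_exponent_le h1 hk

theorem integrable_of_norm_le_of_eq_zero {V F : Type*} [MeasurableSpace V] [PseudoMetricSpace V]
    [ProperSpace V] [BorelSpace V] [NormedAddCommGroup F] {ν : Measure V}
    [IsLocallyFiniteMeasure ν] {g : V → F} (hg : AEStronglyMeasurable g ν) {C R : ℝ} {x₀ : V}
    (hC : ∀ x, ‖g x‖ ≤ C) (hR : ∀ x, R < dist x x₀ → g x = 0) : Integrable g ν := by
  rw [← integrableOn_iff_integrable_of_support_subset (s := closedBall x₀ R)]
  · exact Measure.integrableOn_of_bounded (M := C)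
      (isCompact_closedBall x₀ R).measure_lt_top.ne hg (Eventually.of_forall hC)
  · intro x hx
    by_contra h
    exact hx (hR x (by simpa using h))

theorem IsNice.nullSingletonClass (hs : 0 < s) (hμ : IsNice s Λ μ) : NullSingletonClass μ := by
  refine ⟨fun x => ?_⟩
  have h : Tendsto (fun r : ℝ => ENNReal.ofReal (Λ * r ^ s)) (𝓝[>] 0) (𝓝 0) := by
    rw [show (0 : ℝ≥0∞) = ENNReal.ofReal (Λ * 0 ^ s) by simp [Real.zero_rpow hs.ne']]
    refine (ENNReal.continuous_ofReal.tendsto _).comp ?_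
    exact ((((Real.continuous_rpow_const hs.le).tendsto 0).const_mul Λ)).mono_left
      nhdsWithin_le_nhds
  refine le_antisymm (ge_of_tendsto h ?_) bot_le
  filter_upwards [self_mem_nhdsWithin] with r hr
  exact (measure_mono (by simpa using hr)).trans (hμ.growth x r hr)

theorem IsNice.lintegral_weight_lt_top (hs : 0 < s) (hμ : IsNice s Λ μ) :
    ∫⁻ y, ENNReal.ofReal ((1 + ‖y‖) ^ (-(s + 1))) ∂μ < ⊤ := by
  obtain ⟨C, hC⟩ := exists_lintegral_one_add_dist_div_rpow_neg_le hs.le (lt_add_one s) hμ.growth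
  have := hC 0 1 one_pos
  simp only [dist_zero_right, div_one, Real.one_rpow, ENNReal.ofReal_one, mul_one] at this
  exact this.trans_lt ENNReal.coe_lt_top

theorem IsNice.integrable_weight (hs : 0 < s) (hμ : IsNice s Λ μ) :
    Integrable (fun y => (1 + ‖y‖) ^ (-(s + 1))) μ := by
  refine ⟨(by fun_prop : Measurable _).aestronglyMeasurable, ?_⟩
  rw [hasFiniteIntegral_iff_ofReal (Eventually.of_forall fun y => by positivity)]
  exact hμ.lintegral_weight_lt_top hs

/-- By Tonelli: the Lebesgue integral over `x` is bounded uniformly in `y`, and the remaining weight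
`(1 + ‖y‖)^{-(s+1)}` is `μ`-integrable. -/
theorem IsNice.integrable_prod_weight (hs : 0 < s) (hsd : s < d) (hμ : IsNice s Λ μ) :
    Integrable (fun p : EuclideanSpace ℝ (Fin d) × EuclideanSpace ℝ (Fin d) =>
      (1 + ‖p.2‖) ^ (-(s + 1)) * ((1 + ‖p.1‖) ^ (-(d + 1 : ℝ)) * (1 + dist p.1 p.2 ^ (-s))))
      (volume.prod μ) := by
  have := hμ.locallyFinite
  have hmeas : Measurable (fun p : EuclideanSpace ℝ (Fin d) × EuclideanSpace ℝ (Fin d) =>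
      (1 + ‖p.2‖) ^ (-(s + 1)) * ((1 + ‖p.1‖) ^ (-(d + 1 : ℝ)) * (1 + dist p.1 p.2 ^ (-s)))) := by
    fun_prop
  obtain ⟨C, hC⟩ := exists_lintegral_one_add_norm_mul_le (V := EuclideanSpace ℝ (Fin d)) hs.le
    (by simpa using hsd)
  simp only [finrank_euclideanSpace_fin] at hC
  refine ⟨hmeas.aestronglyMeasurable, ?_⟩
  rw [hasFiniteIntegral_iff_ofReal (Eventually.of_forall fun y => by positivity),
    lintegral_prod_symm _ (by fun_prop)]
  calc _ = ∫⁻ y, ENNReal.ofReal ((1 + ‖y‖) ^ (-(s + 1))) *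
        ∫⁻ x, ENNReal.ofReal ((1 + ‖x‖) ^ (-(d + 1 : ℝ)) * (1 + dist x y ^ (-s))) ∂volume ∂μ := by
        refine lintegral_congr fun y => ?_
        rw [← lintegral_const_mul _ (by fun_prop)]
        refine lintegral_congr fun x => ?_
        rw [ENNReal.ofReal_mul (by positivity)]
    _ ≤ ∫⁻ y, ENNReal.ofReal ((1 + ‖y‖) ^ (-(s + 1))) * C ∂μ := by
        gcongr with y
        exact hC y
    _ < ⊤ := by
        rw [lintegral_mul_const _ (by fun_prop)]
        exact ENNReal.mul_lt_top (hμ.lintegral_weight_lt_top hs) ENNReal.coe_lt_top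

/-- At such `x` the kernel `kernelDiff K x` is `μ`-integrable and `DiracBounded` holds, so the
hypothesis on `T̄_μ(1)` can be used almost everywhere. -/
theorem IsNice.ae_integrable_weight (hs : 0 < s) (hsd : s < d) (hμ : IsNice s Λ μ) :
    ∀ᵐ x : EuclideanSpace ℝ (Fin d),
      Integrable (fun y => (1 + ‖y‖) ^ (-(s + 1)) * (1 + dist x y ^ (-s))) μ := by
  have := hμ.locallyFinite
  filter_upwards [(hμ.integrable_prod_weight hs hsd).prod_right_ae] with x hx
  have hx' := hx.const_mul ((1 + ‖x‖) ^ (d + 1 : ℝ))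
  refine hx'.congr (Eventually.of_forall fun y => ?_)
  have h1 : (1 + ‖x‖) ^ (d + 1 : ℝ) * (1 + ‖x‖) ^ (-(d + 1 : ℝ)) = 1 := by
    rw [← Real.rpow_add (by positivity), add_neg_cancel, Real.rpow_zero]
  calc _ = (1 + ‖x‖) ^ (d + 1 : ℝ) * (1 + ‖x‖) ^ (-(d + 1 : ℝ)) *
        ((1 + ‖y‖) ^ (-(s + 1)) * (1 + dist x y ^ (-s))) := by ring
    _ = _ := by rw [h1, one_mul]

theorem diracBounded_of_integrable_weight {x : EuclideanSpace ℝ (Fin d)}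
    (hx : Integrable (fun y => (1 + ‖y‖) ^ (-(s + 1)) * (1 + dist x y ^ (-s))) μ) :
    DiracBounded s μ x := by
  have hc : Continuous fun y : EuclideanSpace ℝ (Fin d) => (1 + ‖y‖) ^ (s + 1) := by
    refine Continuous.rpow_const (by fun_prop) fun y => Or.inl ?_
    positivity
  have h := hx.locallyIntegrable.continuous_mul hc
  refine h.mono (by fun_prop : Measurable _).aestronglyMeasurable (Eventually.of_forall fun y => ?_)
  have h1 : (1 + ‖y‖) ^ (s + 1) * (1 + ‖y‖) ^ (-(s + 1)) = 1 := by
    rw [← Real.rpow_add (by positivity), add_neg_cancel, Real.rpow_zero]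
  rw [← mul_assoc, h1, one_mul, Real.norm_of_nonneg (by positivity),
    Real.norm_of_nonneg (by positivity), one_div, ← Real.rpow_neg (norm_nonneg _),
    ← dist_eq_norm]
  linarith

section KernelDiff

theorem IsSmoothKernel.measurable_farPart (hK : IsSmoothKernel s K) :
    Measurable ({y : EuclideanSpace ℝ (Fin d) | 1 ≤ ‖y‖}.indicator K) :=
  hK.measurable.indicator (measurableSet_le measurable_const measurable_norm)

theorem IsSmoothKernel.norm_farPart_le (hs : 0 ≤ s) (hK : IsSmoothKernel s K)
    (y : EuclideanSpace ℝ (Fin d)) : ‖{y | 1 ≤ ‖y‖}.indicator K y‖ ≤ 1 := by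
  by_cases hy1 : 1 ≤ ‖y‖
  · rw [Set.indicator_of_mem (by exact hy1)]
    exact (hK.bound y).trans (Real.rpow_le_one_of_one_le_of_nonpos hy1 (by linarith))
  · rw [Set.indicator_of_notMem (by exact hy1)]; simp

theorem IsSmoothKernel.measurable_kernelDiff (hK : IsSmoothKernel s K) :
    Measurable fun p : EuclideanSpace ℝ (Fin d) × EuclideanSpace ℝ (Fin d) =>
      kernelDiff K p.1 p.2 :=
  (hK.measurable.comp (measurable_snd.sub measurable_fst)).sub
    (hK.measurable_farPart.comp measurable_snd)

theorem IsSmoothKernel.integrable_kernelDiff (hs : 0 < s) (hK : IsSmoothKernel s K)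
    {x : EuclideanSpace ℝ (Fin d)}
    (hx : Integrable (fun y => (1 + ‖y‖) ^ (-(s + 1)) * (1 + dist x y ^ (-s))) μ) :
    Integrable (kernelDiff K x) μ := by
  obtain ⟨C, hC0, hC⟩ := hK.exists_norm_kernelDiff_le hs.le
  refine (hx.const_mul (C * (1 + ‖x‖) ^ (s + 1))).mono'
    (hK.measurable_kernelDiff.comp measurable_prodMk_left).aestronglyMeasurable
    (Eventually.of_forall fun y => (hC x y).trans (le_of_eq (by ring)))

theorem IsSmoothKernel.integrable_smul_kernelDiff (hs : 0 < s) (hsd : s < d)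
    (hK : IsSmoothKernel s K) (hμ : IsNice s Λ μ) (f : 𝓢(EuclideanSpace ℝ (Fin d), ℂ)) :
    Integrable (fun p : EuclideanSpace ℝ (Fin d) × EuclideanSpace ℝ (Fin d) =>
      f p.1 • kernelDiff K p.1 p.2) (volume.prod μ) := by
  obtain ⟨C, hC0, hC⟩ := hK.exists_norm_kernelDiff_le hs.le
  -- The exponent absorbs the growth `(1 + ‖x‖)^{s+1}` of the kernel bound and leaves the integrable
  -- weight of order `d + 1`.
  obtain ⟨C', hC0', hC'⟩ := exists_norm_le_one_add_norm_rpow f (s + 1 + (d + 1))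
  refine ((hμ.integrable_prod_weight hs hsd).const_mul (C' * C)).mono'
    ((f.continuous.measurable.comp measurable_fst).smul
      hK.measurable_kernelDiff).aestronglyMeasurable
    (Eventually.of_forall fun p => ?_)
  rw [norm_smul]
  have h1 : (1 + ‖p.1‖) ^ (-(s + 1 + (d + 1) : ℝ)) * (1 + ‖p.1‖) ^ (s + 1) =
      (1 + ‖p.1‖) ^ (-(d + 1 : ℝ)) := by
    rw [← Real.rpow_add (by positivity)]; congr 1; ring
  calc ‖f p.1‖ * ‖kernelDiff K p.1 p.2‖ ≤ (C' * (1 + ‖p.1‖) ^ (-(s + 1 + (d + 1) : ℝ))) *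
        (C * ((1 + ‖p.1‖) ^ (s + 1) * (1 + ‖p.2‖) ^ (-(s + 1)) * (1 + dist p.1 p.2 ^ (-s)))) :=
        mul_le_mul (hC' _) (hC _ _) (norm_nonneg _) (by positivity)
    _ = C' * C * ((1 + ‖p.2‖) ^ (-(s + 1)) * (((1 + ‖p.1‖) ^ (-(s + 1 + (d + 1) : ℝ)) *
          (1 + ‖p.1‖) ^ (s + 1)) * (1 + dist p.1 p.2 ^ (-s)))) := by ring
    _ = _ := by rw [h1]

end KernelDiff

section Cutoff

theorem continuous_cutoff (k : ℕ) : Continuous (cutoff k : EuclideanSpace ℝ (Fin d) → ℝ) := by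
  unfold cutoff; fun_prop

theorem cutoff_nonneg (k : ℕ) (y : EuclideanSpace ℝ (Fin d)) : 0 ≤ cutoff k y := le_max_left _ _

theorem cutoff_le_one (k : ℕ) (y : EuclideanSpace ℝ (Fin d)) : cutoff k y ≤ 1 :=
  max_le zero_le_one (min_le_left _ _)

theorem cutoff_eq_one {k : ℕ} {y : EuclideanSpace ℝ (Fin d)} (h : ‖y‖ ≤ k) : cutoff k y = 1 := by
  rw [cutoff, min_eq_left (by linarith), max_eq_right zero_le_one]

theorem cutoff_eq_zero {k : ℕ} {y : EuclideanSpace ℝ (Fin d)} (h : (k : ℝ) + 1 ≤ ‖y‖) :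
    cutoff k y = 0 :=
  max_eq_left ((min_le_right _ _).trans (by linarith))

theorem tendsto_cutoff (y : EuclideanSpace ℝ (Fin d)) :
    Tendsto (fun k => cutoff k y) atTop (𝓝 1) := by
  obtain ⟨n, hn⟩ := exists_nat_ge ‖y‖
  refine tendsto_const_nhds.congr' ?_
  filter_upwards [eventually_ge_atTop n] with k hk
  exact (cutoff_eq_one (hn.trans (by exact_mod_cast hk))).symm

theorem isLipZero_cutoff (k : ℕ) : IsLipZero (cutoff k : EuclideanSpace ℝ (Fin d) → ℝ) := by
  refine ⟨⟨1, ?_⟩, ?_⟩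
  · have h : LipschitzWith 1 fun y : EuclideanSpace ℝ (Fin d) => (k : ℝ) + 1 - ‖y‖ := by
      refine LipschitzWith.of_dist_le_mul fun x y => ?_
      rw [Real.dist_eq, NNReal.coe_one, one_mul, dist_comm, dist_eq_norm]
      rw [sub_sub_sub_cancel_left]
      exact abs_norm_sub_norm_le y x
    exact (h.const_min 1).const_max 0
  · refine HasCompactSupport.intro (isCompact_closedBall 0 ((k : ℝ) + 1)) fun y hy => ?_
    exact cutoff_eq_zero (by simpa using (not_le.mp (by simpa using hy)).le)

end Cutoff

end WienerCZ

/-! ### `T̄_μ(1)` as an absolutely convergent integral plus a constant. -/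

namespace WienerCZ

variable {d d' : ℕ} {s Λ : ℝ} {μ : Measure (EuclideanSpace ℝ (Fin d))}
  {K : EuclideanSpace ℝ (Fin d) → EuclideanSpace ℂ (Fin d')}
  {η φ : EuclideanSpace ℝ (Fin d) → ℝ}

theorem IsLipZero.continuous (h : IsLipZero η) : Continuous η :=
  h.1.choose_spec.continuous

theorem IsLipZero.exists_bound (h : IsLipZero η) : ∃ C : ℝ, 0 ≤ C ∧ ∀ x, |η x| ≤ C := by
  obtain ⟨C, hC⟩ := h.2.exists_bound_of_continuous h.continuous
  exact ⟨max C 0, le_max_right _ _, fun x => (hC x).trans (le_max_left _ _)⟩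

theorem IsLipZero.exists_radius (h : IsLipZero η) :
    ∃ R : ℝ, 0 < R ∧ ∀ x, R < ‖x‖ → η x = 0 := by
  obtain ⟨R, hR⟩ := h.2.isCompact.isBounded.subset_closedBall 0
  refine ⟨max R 1, by positivity, fun x hx => ?_⟩
  by_contra hne
  have := hR (subset_tsupport η hne)
  rw [mem_closedBall_zero_iff] at this
  exact absurd (this.trans (le_max_left R 1)) (not_le.mpr hx)

/-- `antisym` is Lipschitz and vanishes on the diagonal. This lowers the singularity of the pairing
from `|x - y|^{-s}` to `|x - y|^{1-s}`, which is locally integrable against a measure of growth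
`r^s`. -/
theorem exists_abs_antisym_le (hη : IsLipZero η) (hφ : IsLipZero φ) :
    ∃ C : ℝ, 0 ≤ C ∧ ∀ x y, |antisym η φ x y| ≤ C * dist x y := by
  obtain ⟨A, hA0, hA⟩ := hη.exists_bound
  obtain ⟨B, hB0, hB⟩ := hφ.exists_bound
  obtain ⟨L, hL⟩ := hη.1
  obtain ⟨M, hM⟩ := hφ.1
  refine ⟨L * B + A * M, by positivity, fun x y => ?_⟩
  have h1 : |η y - η x| ≤ L * dist x y := by
    rw [dist_comm, ← Real.dist_eq]; exact hL.dist_le_mul y x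
  have h2 : |φ x - φ y| ≤ M * dist x y := by
    rw [← Real.dist_eq]; exact hM.dist_le_mul x y
  have h3 : antisym η φ x y = ((η y - η x) * φ x + η x * (φ x - φ y)) / 2 := by
    rw [antisym]; ring
  have hd := dist_nonneg (x := x) (y := y)
  rw [h3, abs_div, abs_two, div_le_iff₀ two_pos]
  calc _ ≤ |(η y - η x) * φ x| + |η x * (φ x - φ y)| := abs_add_le _ _
    _ ≤ L * dist x y * B + A * (M * dist x y) := by
        rw [abs_mul, abs_mul]
        gcongr
        · exact hB x
        · exact hA x
    _ = (L * B + A * M) * dist x y := by ring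
    _ ≤ _ := by
        have : 0 ≤ (L * B + A * M) * dist x y := by positivity
        linarith

/-- The exponent `max 0 (s - 1)` lies in `[0, s)` for every `s > 0`, as the dyadic bound near the
diagonal requires; for `s ≤ 1` there is no singularity left. -/
theorem mul_rpow_neg_le {s t : ℝ} (hs : 0 < s) (ht : 0 ≤ t) :
    t * t ^ (-s) ≤ t + (if t < 1 then t ^ (-max 0 (s - 1)) else 0) := by
  rcases ht.eq_or_lt with rfl | ht'
  · simp only [zero_mul, zero_add]
    split_ifs <;> positivity
  split_ifs with h
  · have : t * t ^ (-s) = t ^ (1 - s) := by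
      rw [sub_eq_add_neg, Real.rpow_add ht', Real.rpow_one]
    rw [this]
    have : t ^ (1 - s) ≤ t ^ (-max 0 (s - 1)) :=
      Real.rpow_le_rpow_of_exponent_ge ht' h.le (by linarith [le_max_right 0 (s - 1)])
    linarith
  · have := Real.rpow_le_one_of_one_le_of_nonpos (not_lt.mp h) (by linarith : -s ≤ 0)
    rw [add_zero]
    exact mul_le_of_le_one_right ht this

theorem IsSmoothKernel.integrable_pairSmooth (hs : 0 < s) (hK : IsSmoothKernel s K)
    (hμ : IsNice s Λ μ) (hη : IsLipZero η) (hφ : IsLipZero φ) :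
    Integrable (fun p : EuclideanSpace ℝ (Fin d) × EuclideanSpace ℝ (Fin d) =>
      antisym η φ p.1 p.2 • K (p.1 - p.2)) (μ.prod μ) := by
  have := hμ.locallyFinite
  obtain ⟨A, hA0, hA⟩ := exists_abs_antisym_le hη hφ
  obtain ⟨R₁, hR₁, h₁⟩ := hη.exists_radius
  obtain ⟨R₂, hR₂, h₂⟩ := hφ.exists_radius
  set R := max R₁ R₂
  have hR : 0 < R := lt_max_of_lt_left hR₁
  have hβ0 : 0 ≤ max 0 (s - 1) := le_max_left _ _
  have hβs : max 0 (s - 1) < s := max_lt hs (by linarith)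
  set β := max 0 (s - 1)
  obtain ⟨C, hC⟩ := exists_lintegral_ball_rpow_neg_le hβ0 hβs hμ.growth
  have hmeas : Measurable fun p : EuclideanSpace ℝ (Fin d) × EuclideanSpace ℝ (Fin d) =>
      antisym η φ p.1 p.2 • K (p.1 - p.2) := by
    have := hη.continuous
    have := hφ.continuous
    unfold antisym
    exact (by fun_prop : Continuous fun p : EuclideanSpace ℝ (Fin d) ×
      EuclideanSpace ℝ (Fin d) => (η p.2 * φ p.1 - η p.1 * φ p.2) / 2).measurable.smul
      (hK.measurable.comp (measurable_fst.sub measurable_snd))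
  refine ⟨hmeas.aestronglyMeasurable, ?_⟩
  rw [HasFiniteIntegral, lintegral_prod _ hmeas.enorm.aemeasurable]
  have hpt : ∀ x y, ‖antisym η φ x y • K (x - y)‖ₑ ≤
      (closedBall (0 : EuclideanSpace ℝ (Fin d)) R).indicator (fun _ => 1) x *
        (ENNReal.ofReal A * ((closedBall (0 : EuclideanSpace ℝ (Fin d)) R).indicator
          (fun _ => ENNReal.ofReal (2 * R)) y +
        (ball x 1).indicator (fun y => ENNReal.ofReal (dist y x ^ (-β))) y)) := by
    intro x y
    by_cases hxy : ‖x‖ ≤ R ∧ ‖y‖ ≤ R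
    · rw [Set.indicator_of_mem (by simpa using hxy.1), Set.indicator_of_mem (by simpa using hxy.2),
        one_mul]
      have hd : dist x y ≤ 2 * R := by
        rw [dist_eq_norm]
        exact (norm_sub_le _ _).trans (by linarith [hxy.1, hxy.2])
      have hle : ‖antisym η φ x y • K (x - y)‖ ≤
          A * (2 * R + (if dist x y < 1 then dist x y ^ (-β) else 0)) := by
        rw [norm_smul, Real.norm_eq_abs]
        calc _ ≤ A * dist x y * dist x y ^ (-s) := by
              gcongr
              · exact hA x y
              · rw [dist_eq_norm]; exact hK.bound _
          _ = A * (dist x y * dist x y ^ (-s)) := by ring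
          _ ≤ _ := by
              gcongr
              exact (mul_rpow_neg_le hs dist_nonneg).trans (by gcongr)
      rw [← ofReal_norm]
      refine (ENNReal.ofReal_le_ofReal hle).trans (le_of_eq ?_)
      have hite : 0 ≤ if dist x y < 1 then dist x y ^ (-β) else 0 := by split_ifs <;> positivity
      rw [ENNReal.ofReal_mul hA0, ENNReal.ofReal_add (by positivity) hite]
      congr 2
      by_cases h : dist x y < 1
      · rw [if_pos h, Set.indicator_of_mem (by rwa [mem_ball, dist_comm]), dist_comm]
      · rw [if_neg h, Set.indicator_of_notMem (by rwa [mem_ball, dist_comm]), ENNReal.ofReal_zero]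
    · have h0 : antisym η φ x y = 0 := by
        rw [not_and_or, not_le, not_le] at hxy
        rw [antisym]
        rcases hxy with h | h
        · rw [h₁ x ((le_max_left _ _).trans_lt h), h₂ x ((le_max_right _ _).trans_lt h)]; simp
        · rw [h₁ y ((le_max_left _ _).trans_lt h), h₂ y ((le_max_right _ _).trans_lt h)]; simp
      rw [h0, zero_smul, enorm_zero]
      exact bot_le
  have hfin : μ (closedBall (0 : EuclideanSpace ℝ (Fin d)) R) < ⊤ :=
    (isCompact_closedBall _ _).measure_lt_top
  calc _ ≤ ∫⁻ x, ∫⁻ y, (closedBall (0 : EuclideanSpace ℝ (Fin d)) R).indicator (fun _ => 1) x *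
        (ENNReal.ofReal A * ((closedBall (0 : EuclideanSpace ℝ (Fin d)) R).indicator
          (fun _ => ENNReal.ofReal (2 * R)) y +
        (ball x 1).indicator (fun y => ENNReal.ofReal (dist y x ^ (-β))) y)) ∂μ ∂μ :=
        lintegral_mono fun x => lintegral_mono fun y => hpt x y
    _ ≤ ∫⁻ x, (closedBall (0 : EuclideanSpace ℝ (Fin d)) R).indicator (fun _ => 1) x *
        (ENNReal.ofReal A * (ENNReal.ofReal (2 * R) *
          μ (closedBall (0 : EuclideanSpace ℝ (Fin d)) R) + C)) ∂μ := by
        refine lintegral_mono fun x => ?_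
        have hm1 : Measurable fun y => (closedBall (0 : EuclideanSpace ℝ (Fin d)) R).indicator
          (fun _ => ENNReal.ofReal (2 * R)) y := measurable_const.indicator measurableSet_closedBall
        have hm2 : Measurable fun y => (ball x 1).indicator
            (fun y => ENNReal.ofReal (dist y x ^ (-β))) y :=
          (by fun_prop : Measurable _).indicator measurableSet_ball
        have hm3 := hm1.add hm2
        simp only [Pi.add_def] at hm3
        rw [lintegral_const_mul _ (hm3.const_mul _), lintegral_const_mul _ hm3,
          lintegral_add_left hm1,
          lintegral_indicator_const measurableSet_closedBall, lintegral_indicator measurableSet_ball]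
        gcongr
        exact hC x
    _ < ⊤ := by
        rw [lintegral_mul_const _ (measurable_const.indicator measurableSet_closedBall),
          lintegral_indicator_const measurableSet_closedBall, one_mul]
        refine ENNReal.mul_lt_top hfin (ENNReal.mul_lt_top ENNReal.ofReal_lt_top ?_)
        exact ENNReal.add_lt_top.mpr ⟨ENNReal.mul_lt_top ENNReal.ofReal_lt_top hfin,
          ENNReal.coe_lt_top⟩

theorem IsSmoothKernel.integrable_smul_farPart (hs : 0 < s) (hK : IsSmoothKernel s K)
    (hμ : IsNice s Λ μ) (hφ : IsLipZero φ) :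
    Integrable (fun y => φ y • {y | 1 ≤ ‖y‖}.indicator K y) μ := by
  have := hμ.locallyFinite
  obtain ⟨C, hC0, hC⟩ := hφ.exists_bound
  obtain ⟨R, -, hR⟩ := hφ.exists_radius
  refine integrable_of_norm_le_of_eq_zero (x₀ := 0) (C := C * 1) (R := R)
    (hφ.continuous.measurable.smul hK.measurable_farPart).aestronglyMeasurable (fun y => ?_)
    (fun y hy => ?_)
  · rw [norm_smul]
    exact mul_le_mul (hC y) (hK.norm_farPart_le hs.le y) (norm_nonneg _) hC0
  · rw [hR y (by simpa using hy), zero_smul]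

/-- For `φ` vanishing near the support of `η`, the pairing `⟨T(ημ), φ⟩_μ` is an absolutely
convergent double integral. -/
theorem IsSmoothKernel.pairSmooth_eq_of_separated (hs : 0 < s) (hK : IsSmoothKernel s K)
    (hμ : IsNice s Λ μ) (hη : IsLipZero η) (hφ : IsLipZero φ)
    (hsep : ∀ z y, η z ≠ 0 → φ y ≠ 0 → 1 ≤ dist z y) :
    Integrable (fun p : EuclideanSpace ℝ (Fin d) × EuclideanSpace ℝ (Fin d) =>
      (η p.1 * φ p.2) • K (p.2 - p.1)) (μ.prod μ) ∧
    pairSmooth K μ η φ = ∫ p : EuclideanSpace ℝ (Fin d) × EuclideanSpace ℝ (Fin d),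
      (η p.1 * φ p.2) • K (p.2 - p.1) ∂(μ.prod μ) := by
  have := hμ.locallyFinite
  have hηc := hη.continuous
  have hφc := hφ.continuous
  obtain ⟨A, hA0, hA⟩ := hη.exists_bound
  obtain ⟨B, hB0, hB⟩ := hφ.exists_bound
  obtain ⟨R₁, hR₁, h₁⟩ := hη.exists_radius
  obtain ⟨R₂, hR₂, h₂⟩ := hφ.exists_radius
  set G : EuclideanSpace ℝ (Fin d) × EuclideanSpace ℝ (Fin d) → EuclideanSpace ℂ (Fin d') :=
    fun p => (η p.1 * φ p.2) • K (p.2 - p.1) with hG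
  have hGi : Integrable G (μ.prod μ) := by
    refine integrable_of_norm_le_of_eq_zero (x₀ := (0, 0)) (C := A * B * 1) (R := max R₁ R₂)
      (Measurable.aestronglyMeasurable ?_) (fun p => ?_) (fun p hp => ?_)
    · exact (by fun_prop : Continuous fun p : EuclideanSpace ℝ (Fin d) ×
        EuclideanSpace ℝ (Fin d) => η p.1 * φ p.2).measurable.smul
        (hK.measurable.comp (measurable_snd.sub measurable_fst))
    · simp only [hG, norm_smul, norm_mul, Real.norm_eq_abs]
      by_cases h : η p.1 ≠ 0 ∧ φ p.2 ≠ 0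
      · have hd := hsep _ _ h.1 h.2
        have : ‖K (p.2 - p.1)‖ ≤ 1 := by
          refine (hK.bound _).trans ?_
          rw [← dist_eq_norm, dist_comm]
          exact Real.rpow_le_one_of_one_le_of_nonpos hd (by linarith)
        have := hA p.1
        have := hB p.2
        gcongr
      · have : |η p.1| * |φ p.2| = 0 := by
          rw [not_and_or, not_not, not_not] at h
          rcases h with h | h <;> simp [h]
        rw [this, zero_mul]; positivity
    · rw [Prod.dist_eq, dist_zero_right, dist_zero_right, max_lt_iff] at hp
      simp only [hG]
      rcases lt_max_iff.mp (max_lt_iff.mpr hp) with h | h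
      · rw [h₁ _ ((le_max_left _ _).trans_lt h), zero_mul, zero_smul]
      · rw [h₂ _ ((le_max_right _ _).trans_lt h), mul_zero, zero_smul]
  refine ⟨hGi, ?_⟩
  -- As `K` is odd, the antisymmetrized integrand is the average of `G` and its reflection in the
  -- diagonal, which have the same integral.
  have hpt : ∀ p : EuclideanSpace ℝ (Fin d) × EuclideanSpace ℝ (Fin d),
      antisym η φ p.1 p.2 • K (p.1 - p.2) = (1 / 2 : ℝ) • (G p.swap + G p) := by
    intro p
    have hodd : K (p.2 - p.1) = -K (p.1 - p.2) := by rw [← hK.odd, neg_sub]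
    simp only [hG, Prod.fst_swap, Prod.snd_swap, antisym, hodd, smul_neg]
    rw [← sub_eq_add_neg, ← sub_smul, smul_smul]
    congr 1; ring
  rw [pairSmooth]
  simp_rw [hpt]
  rw [integral_smul, integral_add (f := fun p => G p.swap) hGi.swap hGi, integral_prod_swap, ← two_smul ℝ, smul_smul]
  norm_num

theorem IsSmoothKernel.pairSmooth_add (hs : 0 < s) (hK : IsSmoothKernel s K)
    (hμ : IsNice s Λ μ) (hη : IsLipZero η) (hφ : IsLipZero φ)
    {ψ : EuclideanSpace ℝ (Fin d) → ℝ} (hψ : IsLipZero ψ) :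
    pairSmooth K μ η (fun y => φ y - ψ y) = pairSmooth K μ η φ - pairSmooth K μ η ψ := by
  rw [pairSmooth, pairSmooth, pairSmooth, ← integral_sub (hK.integrable_pairSmooth hs hμ hη hφ)
    (hK.integrable_pairSmooth hs hμ hη hψ)]
  congr 1; funext p
  rw [← sub_smul]
  congr 1
  simp only [antisym]; ring

theorem IsLipZero.sub (hη : IsLipZero η) (hφ : IsLipZero φ) :
    IsLipZero fun x => η x - φ x := by
  obtain ⟨L, hL⟩ := hη.1
  obtain ⟨M, hM⟩ := hφ.1
  exact ⟨⟨L + M, hL.sub hM⟩, hη.2.sub hφ.2⟩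

/-- Write the cutoff as a fixed one plus `θ k`, which vanishes near the support of `η`. Because `∫ η
dμ = 1`, the subtracted far part of `θ k` can be moved inside the double integral, where it turns
`K` into `kernelDiff` and makes dominated convergence possible. -/
theorem IsSmoothKernel.exists_tendsto_pairSmooth_sub (hs : 0 < s) (hK : IsSmoothKernel s K)
    (hμ : IsNice s Λ μ) (hη : IsLipZero η) (hη1 : ∫ x, η x ∂μ = 1) :
    ∃ c, Tendsto (fun k : ℕ => pairSmooth K μ η (cutoff k) -
      ∫ y, cutoff k y • {y | 1 ≤ ‖y‖}.indicator K y ∂μ) atTop (𝓝 c) := by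
  have := hμ.locallyFinite
  obtain ⟨R, hR0, hR⟩ := hη.exists_radius
  -- The extra `1` separates the supports of `η` and `θ k` by distance at least `1`.
  obtain ⟨n, hn⟩ := exists_nat_ge (R + 1)
  obtain ⟨C, hC0, hC⟩ := hK.exists_norm_kernelDiff_le hs.le
  set θ : ℕ → EuclideanSpace ℝ (Fin d) → ℝ := fun k y => cutoff k y - cutoff n y with hθ
  have hθlip : ∀ k, IsLipZero (θ k) := fun k => (isLipZero_cutoff k).sub (isLipZero_cutoff n)
  have hθ0 : ∀ k, n ≤ k → ∀ y, ‖y‖ ≤ n → θ k y = 0 := by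
    intro k hk y hy
    simp only [hθ]
    rw [cutoff_eq_one hy, cutoff_eq_one (hy.trans (by exact_mod_cast hk)), sub_self]
  have hθ1 : ∀ k y, |θ k y| ≤ 1 := fun k y => by
    rw [abs_le]
    constructor <;> simp only [hθ] <;>
      linarith [cutoff_nonneg k y, cutoff_nonneg n y, cutoff_le_one k y, cutoff_le_one n y]
  have hsep : ∀ k, n ≤ k → ∀ z y, η z ≠ 0 → θ k y ≠ 0 → ‖z‖ ≤ R ∧ 1 ≤ dist z y := by
    intro k hk z y hz hy
    have h1 : ‖z‖ ≤ R := by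
      by_contra h; exact hz (hR z (not_le.mp h))
    have h2 : (n : ℝ) < ‖y‖ := by
      by_contra h; exact hy (hθ0 k hk y (not_lt.mp h))
    refine ⟨h1, ?_⟩
    rw [dist_comm, dist_eq_norm]
    linarith [norm_sub_norm_le y z]
  set F : ℕ → EuclideanSpace ℝ (Fin d) × EuclideanSpace ℝ (Fin d) → EuclideanSpace ℂ (Fin d') :=
    fun k p => (η p.1 * θ k p.2) • kernelDiff K p.1 p.2 with hF
  have hηi : Integrable η μ := hη.continuous.integrable_of_hasCompactSupport hη.2
  have hdecomp : ∀ k, n ≤ k → pairSmooth K μ η (cutoff k) -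
      ∫ y, cutoff k y • {y | 1 ≤ ‖y‖}.indicator K y ∂μ = (pairSmooth K μ η (cutoff n) -
      ∫ y, cutoff n y • {y | 1 ≤ ‖y‖}.indicator K y ∂μ) + ∫ p, F k p ∂(μ.prod μ) := by
    intro k hk
    obtain ⟨hi, he⟩ := hK.pairSmooth_eq_of_separated hs hμ hη (hθlip k)
      fun z y hz hy => (hsep k hk z y hz hy).2
    have hi2 : Integrable (fun p : EuclideanSpace ℝ (Fin d) × EuclideanSpace ℝ (Fin d) =>
        η p.1 • (θ k p.2 • {y | 1 ≤ ‖y‖}.indicator K p.2)) (μ.prod μ) :=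
      hηi.smul_prod (hK.integrable_smul_farPart hs hμ (hθlip k))
    have e1 : ∫ p, F k p ∂(μ.prod μ) = pairSmooth K μ η (θ k) -
        ∫ y, θ k y • {y | 1 ≤ ‖y‖}.indicator K y ∂μ := by
      have e0 := integral_prod_smul (μ := μ) (ν := μ) η
        fun y => θ k y • {y | 1 ≤ ‖y‖}.indicator K y
      rw [hη1, one_smul] at e0
      rw [he, ← e0, ← integral_sub hi hi2]
      congr 1; funext p
      simp only [hF, kernelDiff, smul_sub, smul_smul]
    have e2 : ∫ y, θ k y • {y | 1 ≤ ‖y‖}.indicator K y ∂μ =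
        ∫ y, cutoff k y • {y | 1 ≤ ‖y‖}.indicator K y ∂μ -
        ∫ y, cutoff n y • {y | 1 ≤ ‖y‖}.indicator K y ∂μ := by
      rw [← integral_sub (hK.integrable_smul_farPart hs hμ (isLipZero_cutoff k))
        (hK.integrable_smul_farPart hs hμ (isLipZero_cutoff n))]
      simp only [hθ, sub_smul]
    have e3 := hK.pairSmooth_add hs hμ hη (isLipZero_cutoff k) (isLipZero_cutoff n)
    rw [e1, e2, show pairSmooth K μ η (θ k) = _ from e3]
    abel
  have hmeas : ∀ k, AEStronglyMeasurable (F k) (μ.prod μ) := fun k => by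
    have h1 := hη.continuous
    have h2 := (hθlip k).continuous
    exact ((by fun_prop : Continuous fun p : EuclideanSpace ℝ (Fin d) ×
        EuclideanSpace ℝ (Fin d) => η p.1 * θ k p.2).measurable.smul
        hK.measurable_kernelDiff).aestronglyMeasurable
  have hlim : Tendsto (fun k => ∫ p, F k p ∂(μ.prod μ)) atTop (𝓝 (∫ p, (η p.1 * (1 - cutoff n p.2)) •
      kernelDiff K p.1 p.2 ∂(μ.prod μ))) := by
    -- On the support of the integrand `‖p.1‖ ≤ R` and `dist p.1 p.2 ≥ 1`, so the kernel bound
    -- reduces to a multiple of `(1 + ‖p.2‖)^{-(s+1)}`.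
    refine tendsto_integral_filter_of_dominated_convergence
      (fun p => |η p.1| * (C * (1 + R) ^ (s + 1) * 2 * (1 + ‖p.2‖) ^ (-(s + 1))))
      (Eventually.of_forall hmeas) ?_ ?_ ?_
    · filter_upwards [eventually_ge_atTop n] with k hk
      refine Eventually.of_forall fun p => ?_
      simp only [hF]
      rw [norm_smul, norm_mul, Real.norm_eq_abs, Real.norm_eq_abs]
      by_cases h : η p.1 ≠ 0 ∧ θ k p.2 ≠ 0
      · obtain ⟨h1, h2⟩ := hsep k hk _ _ h.1 h.2
        have h3 : dist p.1 p.2 ^ (-s) ≤ 1 :=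
          Real.rpow_le_one_of_one_le_of_nonpos h2 (by linarith)
        calc _ ≤ |η p.1| * 1 * (C * ((1 + ‖p.1‖) ^ (s + 1) * (1 + ‖p.2‖) ^ (-(s + 1)) *
              (1 + dist p.1 p.2 ^ (-s)))) := by
              gcongr
              · exact hθ1 k _
              · exact hC _ _
          _ ≤ |η p.1| * 1 * (C * ((1 + R) ^ (s + 1) * (1 + ‖p.2‖) ^ (-(s + 1)) * (1 + 1))) := by
              gcongr
          _ = _ := by ring
      · have : |η p.1| * |θ k p.2| = 0 := by
          rw [not_and_or, not_not, not_not] at h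
          rcases h with h | h <;> simp [h]
        rw [this, zero_mul]; positivity
    · exact hηi.abs.mul_prod ((hμ.integrable_weight hs).const_mul _)
    · refine Eventually.of_forall fun p => ?_
      exact ((((tendsto_cutoff p.2).sub_const _).const_mul _).smul_const _)
  refine ⟨_, (hlim.const_add (pairSmooth K μ η (cutoff n) -
      ∫ y, cutoff n y • {y | 1 ≤ ‖y‖}.indicator K y ∂μ)).congr' ?_⟩
  filter_upwards [eventually_ge_atTop n] with k hk
  exact (hdecomp k hk).symm

theorem IsSmoothKernel.pairDirac_cutoff_eq (hs : 0 < s) (hK : IsSmoothKernel s K)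
    (hμ : IsNice s Λ μ) {x : EuclideanSpace ℝ (Fin d)} (hx : Integrable (kernelDiff K x) μ)
    (k : ℕ) : pairDirac K μ x (cutoff k) = (∫ y, cutoff k y • kernelDiff K x y ∂μ) +
      ∫ y, cutoff k y • {y | 1 ≤ ‖y‖}.indicator K y ∂μ := by
  have h1 : Integrable (fun y => cutoff k y • kernelDiff K x y) μ :=
    hx.bdd_smul 1 (continuous_cutoff k).aestronglyMeasurable
      (Eventually.of_forall fun y => by
        rw [Real.norm_of_nonneg (cutoff_nonneg k y)]; exact cutoff_le_one k y)
  rw [← integral_add h1 (hK.integrable_smul_farPart hs hμ (isLipZero_cutoff k)), pairDirac]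
  congr 1; funext y
  rw [← smul_add, kernelDiff, sub_add_cancel]

/-- The difference `∫ (K (y - x) - 1_{|y| ≥ 1} K y) dμ(y)` between `T̄_μ(1)(x)` and a constant. -/
theorem IsSmoothKernel.exists_Tbar_eq (hs : 0 < s) (hK : IsSmoothKernel s K)
    (hμ : IsNice s Λ μ) (hη : IsLipZero η) (hη1 : ∫ x, η x ∂μ = 1) :
    ∃ c, ∀ x, Integrable (kernelDiff K x) μ →
      Tbar K μ η (fun _ => 1) x = (∫ y, kernelDiff K x y ∂μ) - c := by
  obtain ⟨c, hc⟩ := hK.exists_tendsto_pairSmooth_sub hs hμ hη hη1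
  refine ⟨c, fun x hx => ?_⟩
  have h1 : Tendsto (fun k : ℕ => ∫ y, cutoff k y • kernelDiff K x y ∂μ) atTop
      (𝓝 (∫ y, kernelDiff K x y ∂μ)) := by
    refine tendsto_integral_of_dominated_convergence (fun y => ‖kernelDiff K x y‖)
      (fun k => (continuous_cutoff k).aestronglyMeasurable.smul hx.1) hx.norm
      (fun k => Eventually.of_forall fun y => ?_) (Eventually.of_forall fun y => ?_)
    · rw [norm_smul, Real.norm_of_nonneg (cutoff_nonneg k y)]
      exact mul_le_of_le_one_left (norm_nonneg _) (cutoff_le_one k y)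
    · simpa using (tendsto_cutoff y).smul_const (kernelDiff K x y)
  refine Tendsto.limUnder_eq ((h1.sub hc).congr fun k => ?_)
  simp only [mul_one]
  rw [hK.pairDirac_cutoff_eq hs hμ hx k]
  abel

/-- Integrate `f x • kernelDiff K x y` in both orders. With `y` first, the inner integral is `f x •
(Γ + c)`, which integrates to zero as `∫ f = 0`. With `x` first, the correction `1_{|y| ≥ 1} K y`
drops out for the same reason. -/
theorem IsSmoothKernel.integral_smul_kernel_eq_zero (hs : 0 < s) (hsd : s < d)
    (hK : IsSmoothKernel s K) (hμ : IsNice s Λ μ) (hη : IsLipZero η) (hη1 : ∫ x, η x ∂μ = 1)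
    {Γ : EuclideanSpace ℂ (Fin d')}
    (hT : ∀ᵐ x : EuclideanSpace ℝ (Fin d), DiracBounded s μ x → Tbar K μ η (fun _ => 1) x = Γ)
    (f : 𝓢(EuclideanSpace ℝ (Fin d), ℂ)) (hf : ∫ x, f x = 0) :
    Integrable (fun y => ∫ x, f x • K (y - x)) μ ∧ ∫ y, (∫ x, f x • K (y - x)) ∂μ = 0 := by
  have := hμ.locallyFinite
  obtain ⟨c, hc⟩ := hK.exists_Tbar_eq hs hμ hη hη1
  have hint := hK.integrable_smul_kernelDiff hs hsd hμ f
  have hinner : (fun y => ∫ x, f x • kernelDiff K x y) =ᵐ[μ] fun y => ∫ x, f x • K (y - x) := by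
    filter_upwards [hint.prod_left_ae] with y hy
    have h1 : Integrable fun x => f x • {y | 1 ≤ ‖y‖}.indicator K y :=
      f.integrable.smul_const _
    have h2 : ∫ x, f x • K (y - x) = ∫ x, (f x • kernelDiff K x y +
        f x • {y | 1 ≤ ‖y‖}.indicator K y) := by
      congr 1; funext x
      rw [← smul_add, kernelDiff, sub_add_cancel]
    rw [h2, integral_add hy h1, integral_smul_const, hf, zero_smul, add_zero]
  refine ⟨hint.integral_prod_right.congr hinner, ?_⟩
  rw [← integral_congr_ae hinner, ← integral_integral_swap (f := fun x y => f x • kernelDiff K x y)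
    hint]
  have hconst : ∀ᵐ x : EuclideanSpace ℝ (Fin d), ∫ y, f x • kernelDiff K x y ∂μ =
      f x • (Γ + c) := by
    filter_upwards [hT, hμ.ae_integrable_weight hs hsd] with x hx1 hx2
    have h1 := hK.integrable_kernelDiff hs hx2
    have h2 := hc x h1
    rw [hx1 (diracBounded_of_integrable_weight hx2)] at h2
    rw [integral_smul, h2, sub_add_cancel]
  rw [integral_congr_ae hconst, integral_smul_const, hf, zero_smul]

end WienerCZ

/-! ### Functions homogeneous at infinity, and integration by parts in Fourier integrals. -/

namespace WienerCZ

section HomogeneousAtInfinity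

variable {V E : Type*} [NormedAddCommGroup V] [InnerProductSpace ℝ V]
  [NormedAddCommGroup E] [NormedSpace ℝ E]

/-- `G` is smooth and coincides for `|x| > 2` with a function that is smooth away from the origin
and homogeneous of order `-a`. -/
def IsHomogeneousAtInfinity (a : ℝ) (G : V → E) : Prop :=
  ContDiff ℝ ∞ G ∧ ∃ L : V → E, ContDiffOn ℝ ∞ L {0}ᶜ ∧
    (∀ x, x ≠ 0 → ∀ t : ℝ, 0 < t → L (t • x) = t ^ (-a) • L x) ∧ ∀ x, 2 < ‖x‖ → G x = L x

/-- Each derivative lowers the degree of homogeneity by one, so differentiating often enough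
produces any required decay. -/
theorem IsHomogeneousAtInfinity.fderiv_apply {a : ℝ} {G : V → E}
    (hG : IsHomogeneousAtInfinity a G) (v : V) :
    IsHomogeneousAtInfinity (a + 1) fun x => fderiv ℝ G x v := by
  obtain ⟨hG, L, hL, hom, heq⟩ := hG
  refine ⟨(hG.fderiv_right (m := ∞) (by simp)).clm_apply contDiff_const,
    fun x => fderiv ℝ L x v, ?_, ?_, ?_⟩
  · exact (hL.fderiv_of_isOpen isOpen_compl_singleton (by simp)).clm_apply contDiffOn_const
  · intro x hx t ht
    have h1 : fderiv ℝ (fun x => L (t • x)) x = fderiv ℝ (fun x => t ^ (-a) • L x) x := by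
      refine EventuallyEq.fderiv_eq ?_
      filter_upwards [isOpen_ne.mem_nhds hx] with y hy
      exact hom y hy t ht
    have h2 : DifferentiableAt ℝ L x :=
      (hL.differentiableOn (by simp)).differentiableAt (isOpen_compl_singleton.mem_nhds hx)
    rw [fderiv_comp_smul, fderiv_fun_const_smul h2] at h1
    have h3 : fderiv ℝ L (t • x) = t⁻¹ • t ^ (-a) • fderiv ℝ L x := by
      rw [← h1, smul_smul, inv_mul_cancel₀ ht.ne', one_smul]
    simp only [h3, _root_.smul_apply, smul_smul]
    congr 1
    rw [neg_add, Real.rpow_add ht, Real.rpow_neg_one, mul_comm]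
  · intro x hx
    have : fderiv ℝ G x = fderiv ℝ L x := by
      refine EventuallyEq.fderiv_eq ?_
      filter_upwards [(isOpen_lt continuous_const continuous_norm).mem_nhds hx] with y hy
      exact heq y hy
    simp only [this]

theorem IsHomogeneousAtInfinity.iterate_fderiv_apply {a : ℝ} {G : V → E}
    (hG : IsHomogeneousAtInfinity a G) (v : V) (N : ℕ) :
    IsHomogeneousAtInfinity (a + N) ((fun G x => fderiv ℝ G x v)^[N] G) := by
  induction N with
  | zero => simpa using hG
  | succ N ih =>
    rw [Function.iterate_succ_apply']
    have := ih.fderiv_apply v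
    rwa [add_assoc, ← Nat.cast_add_one] at this

theorem IsHomogeneousAtInfinity.exists_norm_le [FiniteDimensional ℝ V] {a : ℝ} (ha : 0 ≤ a)
    {G : V → E} (hG : IsHomogeneousAtInfinity a G) :
    ∃ C : ℝ, 0 ≤ C ∧ ∀ x, ‖G x‖ ≤ C * (1 + ‖x‖) ^ (-a) := by
  obtain ⟨hG, L, hL, hom, heq⟩ := hG
  obtain ⟨A, hA⟩ := (isCompact_closedBall (0 : V) 2).exists_bound_of_continuousOn
    hG.continuous.continuousOn
  obtain ⟨B, hB⟩ := (isCompact_sphere (0 : V) 1).exists_bound_of_continuousOn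
    (hL.continuousOn.mono (by rintro x hx rfl; simp at hx))
  refine ⟨|A| * 3 ^ a + |B| * 2 ^ a, by positivity, fun x => ?_⟩
  have hx0 := norm_nonneg x
  rw [Real.rpow_neg (by positivity), ← div_eq_mul_inv, le_div_iff₀ (by positivity)]
  rcases le_or_gt ‖x‖ 2 with h | h
  · have h1 : ‖G x‖ ≤ |A| := (hA x (by simpa using h)).trans (le_abs_self A)
    have h2 : (1 + ‖x‖) ^ a ≤ 3 ^ a := Real.rpow_le_rpow (by positivity) (by linarith) ha
    have h3 : 0 ≤ |B| * 2 ^ a := by positivity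
    have := mul_le_mul h1 h2 (by positivity) (abs_nonneg A)
    linarith
  · have hpos : 0 < ‖x‖ := by linarith
    have hxne : x ≠ 0 := norm_pos_iff.mp hpos
    have h1 : ‖G x‖ * ‖x‖ ^ a ≤ |B| := by
      have h2 := hom x hxne _ (inv_pos.mpr hpos)
      have h3 : ‖L (‖x‖⁻¹ • x)‖ ≤ |B| := by
        refine (hB _ ?_).trans (le_abs_self B)
        rw [mem_sphere_zero_iff_norm, norm_smul, norm_inv, norm_norm, inv_mul_cancel₀ hpos.ne']
      rw [h2, norm_smul, Real.norm_of_nonneg (by positivity), Real.inv_rpow hx0,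
        Real.rpow_neg hx0, inv_inv, mul_comm] at h3
      rwa [heq x h]
    have h2 : (1 + ‖x‖) ^ a ≤ 2 ^ a * ‖x‖ ^ a := by
      rw [← Real.mul_rpow zero_le_two hx0]
      exact Real.rpow_le_rpow (by positivity) (by linarith) ha
    calc ‖G x‖ * (1 + ‖x‖) ^ a ≤ ‖G x‖ * (2 ^ a * ‖x‖ ^ a) := by gcongr
      _ = (‖G x‖ * ‖x‖ ^ a) * 2 ^ a := by ring
      _ ≤ |B| * 2 ^ a := by gcongr
      _ ≤ _ := by
        have : 0 ≤ |A| * 3 ^ a := by positivity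
        linarith

end HomogeneousAtInfinity

section FourierIBP

variable {V E : Type*} [NormedAddCommGroup V] [InnerProductSpace ℝ V] [FiniteDimensional ℝ V]
  [MeasurableSpace V] [BorelSpace V] [NormedAddCommGroup E] [NormedSpace ℂ E]

theorem integrable_schwartz_smul (g : 𝓢(V, ℂ)) {G : V → E} {C : ℝ} (hG : Continuous G)
    (hC : ∀ x, ‖G x‖ ≤ C) : Integrable fun x => g x • G x :=
  g.integrable.smul_bdd C hG.aestronglyMeasurable (Eventually.of_forall hC)

omit [MeasurableSpace V] [BorelSpace V] in
theorem IsHomogeneousAtInfinity.exists_bound {a : ℝ} (ha : 0 ≤ a) {G : V → E}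
    (hG : IsHomogeneousAtInfinity a G) : ∃ C : ℝ, ∀ x, ‖G x‖ ≤ C := by
  obtain ⟨C, hC0, hC⟩ := hG.exists_norm_le ha
  refine ⟨C, fun x => (hC x).trans (mul_le_of_le_one_right hC0 ?_)⟩
  exact Real.rpow_le_one_of_one_le_of_nonpos (by linarith [norm_nonneg x]) (by linarith)

open LineDeriv in
theorem IsHomogeneousAtInfinity.integral_iterate_lineDeriv_smul {a : ℝ} (ha : 0 ≤ a) {G : V → E}
    (hG : IsHomogeneousAtInfinity a G) (v : V) (N : ℕ) (g : 𝓢(V, ℂ)) :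
    ∫ x, ((fun g : 𝓢(V, ℂ) => ∂_{v} g)^[N] g) x • G x =
      (-1 : ℝ) ^ N • ∫ x, g x • ((fun G x => fderiv ℝ G x v)^[N] G) x := by
  induction N generalizing g with
  | zero => simp
  | succ N ih =>
    have hN := hG.iterate_fderiv_apply v N
    have hN1 := hG.iterate_fderiv_apply v (N + 1)
    rw [Function.iterate_succ_apply, ih, Function.iterate_succ_apply']
    rw [Function.iterate_succ_apply'] at hN1
    set H := (fun G x => fderiv ℝ G x v)^[N] G
    obtain ⟨A, hA⟩ := hN.exists_bound (by positivity)
    obtain ⟨B, hB⟩ := hN1.exists_bound (by positivity)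
    have hg : ∀ x, (∂_{v} g : 𝓢(V, ℂ)) x = fderiv ℝ g x v := fun x =>
      SchwartzMap.lineDerivOp_apply_eq_fderiv v g x
    have h1 : Integrable fun x => fderiv ℝ g x v • H x := by
      simp_rw [← hg]
      exact integrable_schwartz_smul _ hN.1.continuous hA
    have key := integral_smul_fderiv_eq_neg_fderiv_smul_of_integrable (μ := volume)
      (f := (g : V → ℂ)) (g := H) (v := v) h1
      (integrable_schwartz_smul _ hN1.1.continuous hB)
      (integrable_schwartz_smul _ hN.1.continuous hA)
      (fun x _ => g.differentiableAt) (fun x _ => hN.1.differentiable (by simp) x)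
    simp_rw [hg]
    rw [key, pow_succ, mul_neg_one, neg_smul, smul_neg, neg_neg]

open LineDeriv in
theorem iterate_lineDeriv_fourier (v : V) (N : ℕ) {h φ : 𝓢(V, ℂ)}
    (hφ : ∀ ξ, φ ξ = (-(2 * Real.pi * Complex.I) * (inner ℝ ξ v : ℝ)) ^ N * h ξ) :
    (fun g : 𝓢(V, ℂ) => ∂_{v} g)^[N] (𝓕 h) = 𝓕 φ := by
  induction N generalizing φ with
  | zero =>
    have : φ = h := by ext ξ; simpa using hφ ξ
    rw [this]; rfl
  | succ N ih =>
    have hT : (fun ξ : V => (inner ℝ ξ v : ℝ)).HasTemperateGrowth := by fun_prop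
    -- The induction needs the intermediate product of `h` with the `N`-th power of the symbol as a
    -- Schwartz function, hence its construction by iterated multiplication operators.
    set ψ : 𝓢(V, ℂ) := ((fun g : 𝓢(V, ℂ) => -(2 * Real.pi * Complex.I) •
      SchwartzMap.smulLeftCLM ℂ (fun ξ : V => (inner ℝ ξ v : ℝ)) g)^[N] h) with hψ
    have hψx : ∀ M : ℕ, ∀ ξ, ((fun g : 𝓢(V, ℂ) => -(2 * Real.pi * Complex.I) •
      SchwartzMap.smulLeftCLM ℂ (fun ξ : V => (inner ℝ ξ v : ℝ)) g)^[M] h) ξ =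
        (-(2 * Real.pi * Complex.I) * (inner ℝ ξ v : ℝ)) ^ M * h ξ := by
      intro M ξ
      induction M with
      | zero => simp
      | succ M ihM =>
        rw [Function.iterate_succ_apply', _root_.smul_apply,
          SchwartzMap.smulLeftCLM_apply_apply hT, ihM, smul_eq_mul, Complex.real_smul, pow_succ]
        ring
    rw [Function.iterate_succ_apply', ih (hψx N), SchwartzMap.lineDerivOp_fourier_eq]
    congr 1
    ext ξ
    rw [_root_.smul_apply, SchwartzMap.smulLeftCLM_apply_apply hT, hψx N, hφ, smul_eq_mul,
      Complex.real_smul, pow_succ]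
    ring

theorem integral_fourier_smul [CompleteSpace E] (f : 𝓢(V, ℂ)) {G : V → E} (hG : Integrable G) :
    ∫ x, 𝓕 (f : V → ℂ) x • G x = ∫ ξ, f ξ • 𝓕 G ξ := by
  have := VectorFourier.integral_fourierIntegral_smul_eq_flip (μ := (volume : Measure V))
    (ν := (volume : Measure V)) (L := innerₗ V) Real.continuous_fourierChar continuous_inner
    f.integrable hG
  rw [flip_innerₗ] at this
  exact this

end FourierIBP

end WienerCZ

/-! ### Smoothness of the multiplier away from the origin. -/

namespace WienerCZ

variable {d d' : ℕ} {s : ℝ} {K : EuclideanSpace ℝ (Fin d) → EuclideanSpace ℂ (Fin d')}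
  {m : sphere (0 : EuclideanSpace ℝ (Fin d)) 1 → EuclideanSpace ℂ (Fin d')}

theorem integrable_smul_of_tsupport_subset {V E : Type*} [TopologicalSpace V] [MeasurableSpace V]
    [OpensMeasurableSpace V] [NormedAddCommGroup E] [NormedSpace ℂ E] {ν : Measure V}
    [IsFiniteMeasureOnCompacts ν] [SecondCountableTopologyEither V E] {W : Set V} (hW : IsOpen W)
    {φ : V → ℂ} (hφ : Continuous φ) (hφc : HasCompactSupport φ) (hφW : tsupport φ ⊆ W)
    {F : V → E} (hF : ContinuousOn F W) : Integrable (fun ξ => φ ξ • F ξ) ν := by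
  have hc : Continuous fun ξ => φ ξ • F ξ := by
    rw [continuous_iff_continuousAt]
    intro ξ
    by_cases hξ : ξ ∈ tsupport φ
    · exact hφ.continuousAt.smul (hF.continuousAt (hW.mem_nhds (hφW hξ)))
    · refine (continuousAt_const (y := 0)).congr ?_
      filter_upwards [(notMem_tsupport_iff_eventuallyEq.mp hξ)] with y hy
      simp [hy]
  exact hc.integrable_of_hasCompactSupport (hφc.smul_right (f' := F))

theorem continuousOn_homogeneousMultiplier (hm : Continuous m) :
    ContinuousOn (homogeneousMultiplier s m) {0}ᶜ := by
  rw [continuousOn_iff_continuous_domRestrict]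
  have h1 : ({0}ᶜ : Set (EuclideanSpace ℝ (Fin d))).domRestrict (homogeneousMultiplier s m) =
      fun ξ : ({0}ᶜ : Set (EuclideanSpace ℝ (Fin d))) => (‖(ξ : EuclideanSpace ℝ (Fin d))‖ ^ ((d : ℝ) - s))⁻¹ • m (toSphere ξ ξ.2) := by
    funext ξ
    rw [Set.domRestrict_apply, homogeneousMultiplier, dif_neg (Set.mem_compl_singleton_iff.mp ξ.2)]
  rw [h1]
  have hne : ∀ ξ : ({0}ᶜ : Set (EuclideanSpace ℝ (Fin d))), ‖(ξ : EuclideanSpace ℝ (Fin d))‖ ≠ 0 :=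
    fun ξ => norm_ne_zero_iff.mpr ξ.2
  have hcn : Continuous fun ξ : ({0}ᶜ : Set (EuclideanSpace ℝ (Fin d))) =>
      ‖(ξ : EuclideanSpace ℝ (Fin d))‖ := continuous_subtype_val.norm
  refine Continuous.fun_smul ?_ (hm.comp ?_)
  · refine Continuous.inv₀ (hcn.rpow_const fun ξ => Or.inl (hne ξ)) fun ξ => ?_
    have := hne ξ
    positivity
  · exact ((hcn.inv₀ hne).smul continuous_subtype_val).subtype_mk _

theorem homogeneousMultiplier_ne_zero (hm : ∀ θ, m θ ≠ 0) {ξ : EuclideanSpace ℝ (Fin d)}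
    (hξ : ξ ≠ 0) : homogeneousMultiplier s m ξ ≠ 0 := by
  rw [homogeneousMultiplier, dif_neg hξ]
  have := norm_ne_zero_iff.mpr hξ
  exact smul_ne_zero (by positivity) (hm _)

theorem IsSmoothKernel.integrable_smul_of_hasCompactSupport (hs : 0 < s) (hsd : s < d)
    (hK : IsSmoothKernel s K) {χ : EuclideanSpace ℝ (Fin d) → ℝ} (hχ : Continuous χ)
    (hχc : HasCompactSupport χ) : Integrable fun x => χ x • K x := by
  obtain ⟨C, hC⟩ := hχc.exists_bound_of_continuous hχ
  obtain ⟨D, hD⟩ := exists_lintegral_one_add_norm_mul_le (V := EuclideanSpace ℝ (Fin d)) hs.le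
    (by simpa using hsd)
  have hw : Continuous fun x : EuclideanSpace ℝ (Fin d) => (1 + ‖x‖) ^ (d + 1 : ℝ) :=
    Continuous.rpow_const (by fun_prop) fun y => Or.inl (by positivity)
  obtain ⟨A, hA⟩ := (hχc.mul_right (f' := fun x : EuclideanSpace ℝ (Fin d) =>
    (1 + ‖x‖) ^ (d + 1 : ℝ))).exists_bound_of_continuous (hχ.mul hw)
  have hint : Integrable fun x : EuclideanSpace ℝ (Fin d) =>
      (1 + ‖x‖) ^ (-(d + 1 : ℝ)) * (1 + dist x 0 ^ (-s)) := by
    refine ⟨(by fun_prop : Measurable _).aestronglyMeasurable, ?_⟩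
    rw [hasFiniteIntegral_iff_ofReal (Eventually.of_forall fun y => by positivity)]
    have := hD 0
    rw [finrank_euclideanSpace_fin] at this
    exact this.trans_lt ENNReal.coe_lt_top
  refine (hint.const_mul A).mono'
    (hχ.measurable.smul hK.measurable).aestronglyMeasurable (Eventually.of_forall fun x => ?_)
  have h1 : (1 + ‖x‖) ^ (d + 1 : ℝ) * (1 + ‖x‖) ^ (-(d + 1 : ℝ)) = 1 := by
    rw [← Real.rpow_add (by positivity), add_neg_cancel, Real.rpow_zero]
  have h2 := hA x
  simp only [Pi.mul_apply] at h2
  rw [norm_mul, Real.norm_of_nonneg (by positivity : 0 ≤ (1 + ‖x‖) ^ (d + 1 : ℝ))] at h2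
  rw [norm_smul, dist_zero_right]
  calc ‖χ x‖ * ‖K x‖ ≤ ‖χ x‖ * (1 + ‖x‖ ^ (-s)) := by
        gcongr
        linarith [hK.bound x]
    _ = (‖χ x‖ * (1 + ‖x‖) ^ (d + 1 : ℝ)) * ((1 + ‖x‖) ^ (-(d + 1 : ℝ)) * (1 + ‖x‖ ^ (-s))) := by
        linear_combination (-(‖χ x‖ * (1 + ‖x‖ ^ (-s)))) * h1
    _ ≤ _ := by gcongr

/-- A smooth cutoff equal to `1` on the unit ball and supported in the ball of radius `2`. -/
noncomputable def unitBump (d : ℕ) : ContDiffBump (0 : EuclideanSpace ℝ (Fin d)) :=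
  ⟨1, 2, one_pos, one_lt_two⟩

theorem IsSmoothKernel.isHomogeneousAtInfinity (hK : IsSmoothKernel s K) :
    IsHomogeneousAtInfinity s fun x => (1 - unitBump d x) • K x := by
  refine ⟨?_, K, hK.smooth, fun x _ t ht => hK.hom x t ht, fun x hx => ?_⟩
  · rw [contDiff_iff_contDiffAt]
    intro x
    rcases eq_or_ne x 0 with rfl | hx
    · refine (contDiffAt_const (c := 0)).congr_of_eventuallyEq ?_
      filter_upwards [(unitBump d).eventuallyEq_one] with y hy
      simp [hy]
    · exact (contDiffAt_const.sub (unitBump d).contDiff.contDiffAt).smul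
        (hK.smooth.contDiffAt (isOpen_compl_singleton.mem_nhds hx))
  · change (1 - unitBump d x) • K x = K x
    rw [(unitBump d).zero_of_le_dist (by simpa [unitBump] using hx.le), sub_zero, one_smul]

/-- Decay of order `a > d + n` makes the moments of order up to `n` integrable. -/
theorem IsHomogeneousAtInfinity.contDiff_fourier {a : ℝ} {n : ℕ} (ha : d + n < a)
    {G : EuclideanSpace ℝ (Fin d) → EuclideanSpace ℂ (Fin d')}
    (hG : IsHomogeneousAtInfinity a G) : Integrable G ∧ ContDiff ℝ n (𝓕 G) := by
  have ha0 : 0 ≤ a := by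
    have : (0 : ℝ) ≤ d + n := by positivity
    linarith
  obtain ⟨C, hC0, hC⟩ := hG.exists_norm_le ha0
  have hint : ∀ k : ℕ, k ≤ n → Integrable fun x => ‖x‖ ^ k * ‖G x‖ := by
    intro k hk
    have h1 : Integrable fun x : EuclideanSpace ℝ (Fin d) => (1 + ‖x‖) ^ (-(a - k)) :=
      integrable_one_add_norm (by
        have : (k : ℝ) ≤ n := by exact_mod_cast hk
        rw [finrank_euclideanSpace_fin]
        linarith)
    have hGc := hG.1.continuous
    refine (h1.const_mul C).mono' (by fun_prop) (Eventually.of_forall fun x => ?_)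
    rw [Real.norm_of_nonneg (by positivity), neg_sub, sub_eq_add_neg,
      Real.rpow_add (by positivity), Real.rpow_natCast]
    calc ‖x‖ ^ k * ‖G x‖ ≤ (1 + ‖x‖) ^ k * (C * (1 + ‖x‖) ^ (-a)) := by
          gcongr
          · linarith
          · exact hC x
      _ = _ := by ring
  refine ⟨?_, ?_⟩
  · have := hint 0 (Nat.zero_le _)
    simp only [pow_zero, one_mul] at this
    exact (integrable_norm_iff hG.1.continuous.aestronglyMeasurable).mp this
  · have := Real.contDiff_fourier (f := G) (N := n) fun k hk => hint k (by exact_mod_cast hk)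
    exact_mod_cast this

/-- Split `K` by a bump function. The part near `0` is integrable with compact support, so its
transform is smooth. The part at infinity becomes rapidly decaying after `N` derivatives along `ξ₀`,
which on the Fourier side multiply by a power of `⟨ξ, ξ₀⟩`; this power can be divided out near `ξ₀`.
-/
theorem IsSmoothKernel.contDiffAt_homogeneousMultiplier (hs : 0 < s) (hsd : s < d)
    (hK : IsSmoothKernel s K) (hm : Continuous m) (hKm : HasFourierMultiplier s K m)
    {ξ₀ : EuclideanSpace ℝ (Fin d)} (hξ₀ : ξ₀ ≠ 0) :
    ContDiffAt ℝ ∞ (homogeneousMultiplier s m) ξ₀ := by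
  rw [contDiffAt_infty]
  intro n
  set χ := unitBump d
  set K₂ : EuclideanSpace ℝ (Fin d) → EuclideanSpace ℂ (Fin d') := fun x => (1 - χ x) • K x with hK₂
  have hK₂h : IsHomogeneousAtInfinity s K₂ := hK.isHomogeneousAtInfinity
  set K₁ : EuclideanSpace ℝ (Fin d) → EuclideanSpace ℂ (Fin d') := fun x => χ x • K x with hK₁
  have hK₁i : Integrable K₁ :=
    hK.integrable_smul_of_hasCompactSupport hs hsd χ.continuous χ.hasCompactSupport
  have hK₁F : ContDiff ℝ n (𝓕 K₁) := by
    have := Real.contDiff_fourier (f := K₁) (N := n) fun k _ => by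
      have := (hK.integrable_smul_of_hasCompactSupport hs hsd (χ := fun x => ‖x‖ ^ k * χ x)
        ((by fun_prop : Continuous fun x : EuclideanSpace ℝ (Fin d) => ‖x‖ ^ k).mul χ.continuous)
        χ.hasCompactSupport.mul_left).norm
      refine this.congr (Eventually.of_forall fun x => ?_)
      simp only [hK₁, norm_smul, norm_mul, norm_pow, norm_norm, mul_assoc]
    exact_mod_cast this
  -- With `s > 0`, the decay `s + N` exceeds `d + n`, as needed for a `C^n` transform.
  set N : ℕ := d + n
  set G : EuclideanSpace ℝ (Fin d) → EuclideanSpace ℂ (Fin d') :=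
    (fun G x => fderiv ℝ G x ξ₀)^[N] K₂ with hG
  obtain ⟨hGi, hGF⟩ := (hK₂h.iterate_fderiv_apply ξ₀ N).contDiff_fourier (n := n) (by
    simp only [N]; push_cast; linarith)
  -- An open half-space containing `ξ₀` on which the symbol `q` of the derivative along `ξ₀` does
  -- not vanish.
  set W : Set (EuclideanSpace ℝ (Fin d)) := {ξ | 0 < (inner ℝ ξ ξ₀ : ℝ)} with hW
  have hWo : IsOpen W := isOpen_lt continuous_const (by fun_prop)
  have hW0 : ∀ ξ ∈ W, ξ ≠ 0 := by
    rintro ξ hξ rfl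
    simp [hW] at hξ
  have hξ₀W : ξ₀ ∈ W := by
    simp only [hW, Set.mem_ofPred_eq, real_inner_self_eq_norm_sq]
    have := norm_pos_iff.mpr hξ₀
    positivity
  set q : EuclideanSpace ℝ (Fin d) → ℂ :=
    fun ξ => -(2 * Real.pi * Complex.I) * (inner ℝ ξ ξ₀ : ℝ) with hq
  have hq0 : ∀ ξ ∈ W, q ξ ≠ 0 := by
    intro ξ hξ
    have h1 : ((inner ℝ ξ ξ₀ : ℝ) : ℂ) ≠ 0 := by exact_mod_cast (ne_of_gt hξ)
    simp only [hq]
    refine mul_ne_zero (neg_ne_zero.mpr ?_) h1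
    simp [Real.pi_ne_zero]
  have hqs : ContDiff ℝ ∞ q := by
    refine contDiff_const.mul (Complex.ofRealCLM.contDiff.comp ?_)
    exact contDiff_id.inner ℝ contDiff_const
  set Q : EuclideanSpace ℝ (Fin d) → EuclideanSpace ℂ (Fin d') :=
    fun ξ => 𝓕 K₁ ξ + ((-1) ^ N * (q ξ ^ N)⁻¹) • 𝓕 G ξ with hQ
  have hQs : ∀ ξ ∈ W, ContDiffAt ℝ n Q ξ := by
    intro ξ hξ
    refine hK₁F.contDiffAt.add (ContDiffAt.fun_smul (contDiffAt_const.mul ?_) hGF.contDiffAt)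
    refine ContDiffAt.inv ?_ (pow_ne_zero _ (hq0 ξ hξ))
    exact ((hqs.of_le (by exact_mod_cast le_top)).pow N).contDiffAt
  have hQc : ContinuousOn Q W := fun ξ hξ => (hQs ξ hξ).continuousAt.continuousWithinAt
  have hκc : ContinuousOn (homogeneousMultiplier s m) W :=
    (continuousOn_homogeneousMultiplier hm).mono fun ξ hξ => hW0 ξ hξ
  -- The multiplier and `Q` agree as distributions on `W`: write `g = q ^ N * h` and integrate by
  -- parts `N` times in the part at infinity. Both are continuous on `W`, so they then agree
  -- pointwise.
  have htest : ∀ g : EuclideanSpace ℝ (Fin d) → ℝ, ContDiff ℝ ∞ g → HasCompactSupport g →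
      tsupport g ⊆ W → ∫ x, g x • (homogeneousMultiplier s m x - Q x) = 0 := by
    intro g hg hgc hgW
    have hφs : ContDiff ℝ ∞ fun ξ => (g ξ : ℂ) := Complex.ofRealCLM.contDiff.comp hg
    have hφc : HasCompactSupport fun ξ => (g ξ : ℂ) := hgc.comp_left Complex.ofReal_zero
    have hgz : ∀ ξ, ξ ∉ W → g ξ = 0 := fun ξ hξ => by
      by_contra h
      exact hξ (hgW (subset_tsupport g h))
    have hhs : ContDiff ℝ ∞ fun ξ => (q ξ ^ N)⁻¹ * (g ξ : ℂ) := by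
      rw [contDiff_iff_contDiffAt]
      intro ξ
      by_cases hξ : ξ ∈ tsupport g
      · exact ((hqs.pow N).contDiffAt.inv (pow_ne_zero _ (hq0 ξ (hgW hξ)))).mul hφs.contDiffAt
      · refine (contDiffAt_const (c := 0)).congr_of_eventuallyEq ?_
        filter_upwards [(notMem_tsupport_iff_eventuallyEq.mp hξ)] with y hy
        simp [hy]
    set φ : 𝓢(EuclideanSpace ℝ (Fin d), ℂ) := hφc.toSchwartzMap hφs with hφ
    set h : 𝓢(EuclideanSpace ℝ (Fin d), ℂ) := (hφc.mul_left).toSchwartzMap hhs with hh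
    have hφx : ∀ ξ, φ ξ = (g ξ : ℂ) := fun ξ => rfl
    have hhx : ∀ ξ, h ξ = (q ξ ^ N)⁻¹ * (g ξ : ℂ) := fun ξ => rfl
    have hφh : ∀ ξ, φ ξ = q ξ ^ N * h ξ := by
      intro ξ
      rw [hφx, hhx]
      by_cases hξ : ξ ∈ W
      · rw [mul_inv_cancel_left₀ (pow_ne_zero _ (hq0 ξ hξ))]
      · rw [hgz ξ hξ]; simp
    have hφW : tsupport (φ : EuclideanSpace ℝ (Fin d) → ℂ) ⊆ W :=
      (closure_mono fun ξ hξ => by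
        intro h; exact hξ (by rw [hφx]; simp [h])).trans hgW
    have hφ0 : (0 : EuclideanSpace ℝ (Fin d)) ∉ tsupport (φ : EuclideanSpace ℝ (Fin d) → ℂ) :=
      fun h0 => hW0 0 (hφW h0) rfl
    have e0 := hKm φ hφ0
    obtain ⟨B, hB⟩ := hK₂h.exists_bound hs.le
    have i1 : Integrable fun x => 𝓕 (φ : EuclideanSpace ℝ (Fin d) → ℂ) x • K₁ x := by
      have hc := (𝓕 φ).continuous
      obtain ⟨A, -, hA⟩ := exists_norm_le_one_add_norm_rpow (𝓕 φ) 0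
      simp only [neg_zero, Real.rpow_zero, mul_one] at hA
      exact hK₁i.bdd_smul A hc.aestronglyMeasurable (Eventually.of_forall hA)
    have i2 : Integrable fun x => 𝓕 (φ : EuclideanSpace ℝ (Fin d) → ℂ) x • K₂ x :=
      integrable_schwartz_smul (𝓕 φ) hK₂h.1.continuous hB
    have e1 : ∫ x, 𝓕 (φ : EuclideanSpace ℝ (Fin d) → ℂ) x • K x =
        (∫ ξ, φ ξ • 𝓕 K₁ ξ) + ∫ x, 𝓕 (φ : EuclideanSpace ℝ (Fin d) → ℂ) x • K₂ x := by
      rw [← integral_fourier_smul φ hK₁i, ← integral_add i1 i2]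
      congr 1; funext x
      rw [← smul_add]
      congr 1
      simp only [hK₁, hK₂, sub_smul, one_smul, add_sub_cancel]
    have e2 : ∫ x, 𝓕 (φ : EuclideanSpace ℝ (Fin d) → ℂ) x • K₂ x =
        ∫ ξ, φ ξ • (((-1) ^ N * (q ξ ^ N)⁻¹) • 𝓕 G ξ) := by
      have h1 := hK₂h.integral_iterate_lineDeriv_smul hs.le ξ₀ N (𝓕 h)
      rw [iterate_lineDeriv_fourier ξ₀ N hφh] at h1
      have h2 : ∫ x, (𝓕 h) x • G x = ∫ ξ, h ξ • 𝓕 G ξ := integral_fourier_smul h hGi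
      rw [h2, ← integral_smul] at h1
      refine h1.trans ?_
      congr 1; funext ξ
      rw [smul_smul, ← Complex.coe_smul, smul_smul, hhx, hφx]
      congr 1
      push_cast
      ring
    rw [e1, e2] at e0
    have i3 : Integrable fun ξ => φ ξ • 𝓕 K₁ ξ := by
      exact integrable_smul_of_tsupport_subset isOpen_univ φ.continuous hφc (Set.subset_univ _)
        hK₁F.continuous.continuousOn
    have hsupp : ∀ F : EuclideanSpace ℝ (Fin d) → EuclideanSpace ℂ (Fin d'), ContinuousOn F W →
        Integrable fun ξ => φ ξ • F ξ := fun F hF =>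
      integrable_smul_of_tsupport_subset hWo φ.continuous hφc hφW hF
    have i4 : Integrable fun ξ => φ ξ • (((-1) ^ N * (q ξ ^ N)⁻¹) • 𝓕 G ξ) := by
      refine hsupp _ fun ξ hξ => ContinuousAt.continuousWithinAt ?_
      exact (continuousAt_const.mul ((hqs.continuous.pow N).continuousAt.inv₀
        (pow_ne_zero _ (hq0 ξ hξ)))).smul hGF.continuous.continuousAt
    rw [← integral_add i3 i4] at e0
    have e3 : ∫ x, g x • (homogeneousMultiplier s m x - Q x) =
        (∫ ξ, φ ξ • homogeneousMultiplier s m ξ) - ∫ ξ, (φ ξ • 𝓕 K₁ ξ +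
          φ ξ • (((-1) ^ N * (q ξ ^ N)⁻¹) • 𝓕 G ξ)) := by
      have e := integral_sub (hsupp _ hκc) (i3.add i4)
      simp only [Pi.add_apply] at e
      rw [← e]
      congr 1; funext ξ
      rw [← smul_add, ← smul_sub, hφx, Complex.coe_smul]
    rw [e3, e0, sub_self]
  have hae := hWo.ae_eq_zero_of_integral_contDiff_smul_eq_zero (μ := volume)
    ((hκc.sub hQc).locallyIntegrableOn hWo.measurableSet) htest
  have heq : Set.EqOn (homogeneousMultiplier s m) Q W := by
    refine Measure.eqOn_open_of_ae_eq (μ := volume) ?_ hWo hκc hQc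
    refine (ae_restrict_iff' hWo.measurableSet).mpr ?_
    filter_upwards [hae] with ξ h hξ
    exact sub_eq_zero.mp (h hξ)
  refine (hQs ξ₀ hξ₀W).congr_of_eventuallyEq ?_
  filter_upwards [hWo.mem_nhds hξ₀W] with ξ hξ
  exact heq hξ

end WienerCZ

/-! ### Division by the multiplier. -/

namespace WienerCZ

variable {d d' : ℕ} {s Λ : ℝ} {μ : Measure (EuclideanSpace ℝ (Fin d))}
  {K : EuclideanSpace ℝ (Fin d) → EuclideanSpace ℂ (Fin d')}
  {m : sphere (0 : EuclideanSpace ℝ (Fin d)) 1 → EuclideanSpace ℂ (Fin d')}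

section Modulate

variable {V : Type*} [NormedAddCommGroup V] [InnerProductSpace ℝ V]

/-- The function `ξ ↦ e^{2πi⟨ξ, y⟩} φ(ξ)`. -/
noncomputable def modulate (y : V) (φ : V → ℂ) (ξ : V) : ℂ :=
  (Real.fourierChar (inner ℝ ξ y) : ℂ) * φ ξ

theorem contDiff_modulate (y : V) {φ : V → ℂ} (hφ : ContDiff ℝ ∞ φ) :
    ContDiff ℝ ∞ (modulate y φ) :=
by
  refine ContDiff.mul ?_ hφ
  simp only [Real.fourierChar_apply]
  exact (Complex.ofRealCLM.contDiff.comp (contDiff_const.mul (contDiff_id.inner ℝ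
    contDiff_const))).mul contDiff_const |>.cexp

theorem hasCompactSupport_modulate (y : V) {φ : V → ℂ} (hφ : HasCompactSupport φ) :
    HasCompactSupport (modulate y φ) := hφ.mul_left

theorem tsupport_modulate_subset (y : V) (φ : V → ℂ) : tsupport (modulate y φ) ⊆ tsupport φ :=
  tsupport_mul_subset_right

variable [FiniteDimensional ℝ V] [MeasurableSpace V] [BorelSpace V]

theorem fourier_modulate (y x : V) (φ : V → ℂ) : 𝓕 (modulate y φ) x = 𝓕⁻ φ (y - x) := by
  rw [Real.fourier_eq, Real.fourierInv_eq]
  congr 1; funext ξ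
  simp only [modulate, Circle.smul_def, smul_eq_mul]
  rw [← mul_assoc, ← Circle.coe_mul, ← AddChar.map_add_eq_mul, inner_sub_right]
  ring_nf

theorem fourierInv_modulate (y x : V) (φ : V → ℂ) : 𝓕⁻ (modulate y φ) x = 𝓕⁻ φ (x + y) := by
  rw [Real.fourierInv_eq_fourier_neg, fourier_modulate, sub_neg_eq_add, add_comm]

theorem fourierInv_comp_smul (φ : V → ℂ) {r : ℝ} (hr : 0 < r) (x : V) :
    𝓕⁻ (fun ξ => φ (r • ξ)) x = ((r ^ Module.finrank ℝ V)⁻¹ : ℝ) • 𝓕⁻ φ (r⁻¹ • x) := by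
  rw [Real.fourierInv_eq, Real.fourierInv_eq]
  have h := Measure.integral_comp_smul (volume : Measure V)
    (fun ξ => Real.fourierChar (inner ℝ ξ (r⁻¹ • x)) • φ ξ) r
  rw [abs_of_pos (by positivity)] at h
  rw [← h]
  congr 1; funext ξ
  rw [inner_smul_left, inner_smul_right]
  simp [hr.ne']

end Modulate

/-- Division by the multiplier: Schwartz functions `f` that vanish under `μ` after convolution
with `K` produce all functions with Fourier transform in `C_c^∞` away from the origin. -/
theorem IsSmoothKernel.integral_fourierInv_eq_zero_of_notMem_tsupport (hs : 0 < s) (hsd : s < d)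
    (hK : IsSmoothKernel s K) (hmc : Continuous m) (hKm : HasFourierMultiplier s K m)
    (hm0 : ∀ θ, m θ ≠ 0)
    (hμ : ∀ f : 𝓢(EuclideanSpace ℝ (Fin d), ℂ), ∫ x, f x = 0 →
      Integrable (fun y => ∫ x, f x • K (y - x)) μ ∧ ∫ y, (∫ x, f x • K (y - x)) ∂μ = 0)
    {φ : EuclideanSpace ℝ (Fin d) → ℂ} (hφ : ContDiff ℝ ∞ φ) (hφc : HasCompactSupport φ)
    (hφ0 : 0 ∉ tsupport φ) : ∫ y, 𝓕⁻ φ y ∂μ = 0 := by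
  set κ := homogeneousMultiplier s m with hκ
  have hκs : ∀ ξ, ξ ≠ 0 → ContDiffAt ℝ ∞ κ ξ := fun ξ hξ =>
    hK.contDiffAt_homogeneousMultiplier hs hsd hmc hKm hξ
  have hκ0 : ∀ ξ, ξ ≠ 0 → κ ξ ≠ 0 := fun ξ hξ => homogeneousMultiplier_ne_zero hm0 hξ
  have hφU : tsupport φ ⊆ {0}ᶜ := fun ξ hξ h => hφ0 (by rwa [← Set.mem_singleton_iff.mp h])
  have hsupp : ∀ ξ, φ ξ ≠ 0 → ξ ≠ 0 := fun ξ hξ => hφU (subset_tsupport φ hξ)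
  -- Chosen so that `∑ j, ρ j * κ j = φ`; smooth because `κ` is smooth and nonzero on the support of
  -- `φ`.
  set ρ : Fin d' → EuclideanSpace ℝ (Fin d) → ℂ := fun j ξ =>
    ((starRingEnd ℂ) (κ ξ j) * ((‖κ ξ‖ ^ 2 : ℝ) : ℂ)⁻¹) * φ ξ with hρ
  have hρs : ∀ j, ContDiff ℝ ∞ (ρ j) := by
    intro j
    rw [contDiff_iff_contDiffAt]
    intro ξ
    by_cases hξ : ξ ∈ tsupport φ
    · have hξ0 : ξ ≠ 0 := hφU hξ
      have h1 : ContDiffAt ℝ ∞ (fun ξ => κ ξ j) ξ :=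
        (((EuclideanSpace.proj j : EuclideanSpace ℂ (Fin d') →L[ℂ] ℂ).restrictScalars
          ℝ).contDiff.contDiffAt).comp ξ (hκs ξ hξ0)
      have h2 : ContDiffAt ℝ ∞ (fun ξ => (starRingEnd ℂ) (κ ξ j)) ξ :=
        (Complex.conjCLE.contDiff.contDiffAt).comp ξ h1
      have h3 : ContDiffAt ℝ ∞ (fun ξ => ((‖κ ξ‖ ^ 2 : ℝ) : ℂ)) ξ :=
        Complex.ofRealCLM.contDiff.contDiffAt.comp ξ ((hκs ξ hξ0).norm_sq ℂ)
      refine (h2.mul (h3.inv ?_)).mul hφ.contDiffAt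
      have := norm_ne_zero_iff.mpr (hκ0 ξ hξ0)
      exact_mod_cast pow_ne_zero 2 this
    · refine (contDiffAt_const (c := 0)).congr_of_eventuallyEq ?_
      filter_upwards [(notMem_tsupport_iff_eventuallyEq.mp hξ)] with y hy
      simp [hρ, hy]
  have hρc : ∀ j, HasCompactSupport (ρ j) := fun j => hφc.mul_left
  have hρt : ∀ j, tsupport (ρ j) ⊆ {0}ᶜ := fun j => tsupport_mul_subset_right.trans hφU
  set Φ : Fin d' → 𝓢(EuclideanSpace ℝ (Fin d), ℂ) := fun j =>
    (hρc j).toSchwartzMap (hρs j) with hΦ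
  have hΦx : ∀ j, (Φ j : EuclideanSpace ℝ (Fin d) → ℂ) = ρ j := fun j => rfl
  have hfx : ∀ j x, (𝓕⁻ (Φ j)) x = 𝓕⁻ (ρ j) x := fun j x => by
    rw [SchwartzMap.fourierInv_coe, hΦx]
  -- The mean of `𝓕⁻ (Φ j)` is the value of `ρ j` at the origin, which lies outside its support.
  have hf0 : ∀ j, ∫ x, (𝓕⁻ (Φ j)) x = 0 := by
    intro j
    have h1 : 𝓕 (𝓕⁻ (Φ j)) = Φ j := FourierTransform.fourier_fourierInv_eq _
    have h2 : (𝓕 (𝓕⁻ (Φ j))) 0 = ∫ x, (𝓕⁻ (Φ j)) x := by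
      rw [SchwartzMap.fourier_coe, Real.fourier_eq]
      simp
    rw [← h2, h1, hΦx]
    exact image_eq_zero_of_notMem_tsupport fun h => hρt j h rfl
  have hint : ∀ j y, Integrable fun ξ => modulate y (ρ j) ξ • κ ξ := fun j y =>
    integrable_smul_of_tsupport_subset isOpen_compl_singleton
      (contDiff_modulate y (hρs j)).continuous (hasCompactSupport_modulate y (hρc j))
      ((tsupport_modulate_subset y _).trans (hρt j)) (continuousOn_homogeneousMultiplier hmc)
  -- The convolution at `y` is the defining identity of the multiplier tested on the modulation of
  -- `ρ j` by `y`, whose support still avoids the origin.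
  have hconv : ∀ j y, ∫ x, (𝓕⁻ (Φ j)) x • K (y - x) = ∫ ξ, modulate y (ρ j) ξ • κ ξ := by
    intro j y
    have h1 := integral_sub_left_eq_self (μ := volume) (fun x => (𝓕⁻ (Φ j)) x • K (y - x)) y
    rw [← h1]
    have h2 := hKm ((hasCompactSupport_modulate y (hρc j)).toSchwartzMap
      (contDiff_modulate y (hρs j))) fun h => hρt j (tsupport_modulate_subset y _ h) rfl
    refine Eq.trans ?_ h2
    congr 1; funext x
    rw [sub_sub_cancel, hfx, ← fourier_modulate]
    rfl
  have hsum : ∀ y, 𝓕⁻ φ y = ∑ j, (∫ x, (𝓕⁻ (Φ j)) x • K (y - x)) j := by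
    intro y
    have h1 : ∀ j, (∫ x, (𝓕⁻ (Φ j)) x • K (y - x)) j = ∫ ξ, modulate y (ρ j) ξ * κ ξ j := by
      intro j
      rw [hconv]
      exact ((EuclideanSpace.proj j : EuclideanSpace ℂ (Fin d') →L[ℂ] ℂ).integral_comp_comm
        (hint j y)).symm
    simp_rw [h1]
    rw [← integral_finsetSum, Real.fourierInv_eq]
    · congr 1; funext ξ
      have h2 : ∑ j, modulate y (ρ j) ξ * κ ξ j = (Real.fourierChar (inner ℝ ξ y) : ℂ) * φ ξ *
          (((‖κ ξ‖ ^ 2 : ℝ) : ℂ)⁻¹ * ∑ j, (starRingEnd ℂ) (κ ξ j) * κ ξ j) := by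
        rw [Finset.mul_sum, Finset.mul_sum]
        refine Finset.sum_congr rfl fun j _ => ?_
        simp only [modulate, hρ]
        ring
      have h3 : ∑ j, (starRingEnd ℂ) (κ ξ j) * κ ξ j = ((‖κ ξ‖ ^ 2 : ℝ) : ℂ) := by
        rw [EuclideanSpace.norm_sq_eq]
        push_cast
        refine Finset.sum_congr rfl fun j _ => ?_
        rw [Complex.conj_mul']
      rw [h2, h3, Circle.smul_def, smul_eq_mul]
      by_cases hξ : φ ξ = 0
      · simp [hξ]
      · have := norm_ne_zero_iff.mpr (hκ0 ξ (hsupp ξ hξ))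
        rw [inv_mul_cancel₀ (by exact_mod_cast pow_ne_zero 2 this), mul_one]
    · intro j _
      exact (EuclideanSpace.proj j : EuclideanSpace ℂ (Fin d') →L[ℂ] ℂ).integrable_comp (hint j y)
  simp_rw [hsum]
  rw [integral_finsetSum]
  · refine Finset.sum_eq_zero fun j _ => ?_
    obtain ⟨hi, h0⟩ := hμ _ (hf0 j)
    have := (EuclideanSpace.proj j : EuclideanSpace ℂ (Fin d') →L[ℂ] ℂ).integral_comp_comm hi
    rw [h0] at this
    simpa using this
  · intro j _
    exact (EuclideanSpace.proj j : EuclideanSpace ℂ (Fin d') →L[ℂ] ℂ).integrable_comp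
      (hμ _ (hf0 j)).1

end WienerCZ

/-! ### Low frequencies, positivity, and the conclusion. -/

namespace WienerCZ

variable {d d' : ℕ} {s Λ : ℝ} {μ : Measure (EuclideanSpace ℝ (Fin d))}
  {K : EuclideanSpace ℝ (Fin d) → EuclideanSpace ℂ (Fin d')}
  {m : sphere (0 : EuclideanSpace ℝ (Fin d)) 1 → EuclideanSpace ℂ (Fin d')}

theorem IsNice.integrable_schwartz (hs : 0 < s) (hμ : IsNice s Λ μ)
    (u : 𝓢(EuclideanSpace ℝ (Fin d), ℂ)) : Integrable u μ := by
  obtain ⟨C, -, hC⟩ := exists_norm_le_one_add_norm_rpow u (s + 1)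
  exact ((hμ.integrable_weight hs).const_mul C).mono' u.continuous.aestronglyMeasurable
    (Eventually.of_forall hC)

theorem IsNice.exists_lintegral_schwartz_dilation_le (hs : 0 < s) (hμ : IsNice s Λ μ)
    (u : 𝓢(EuclideanSpace ℝ (Fin d), ℂ)) :
    ∃ C : ℝ≥0, ∀ t, ∀ r : ℝ, 0 < r →
      ∫⁻ x, ‖u (r⁻¹ • (x - t))‖ₑ ∂μ ≤ C * ENNReal.ofReal (r ^ s) := by
  obtain ⟨A, hA0, hA⟩ := exists_norm_le_one_add_norm_rpow u (s + 1)
  obtain ⟨C, hC⟩ := exists_lintegral_one_add_dist_div_rpow_neg_le hs.le (lt_add_one s) hμ.growth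
  refine ⟨A.toNNReal * C, fun t r hr => ?_⟩
  calc ∫⁻ x, ‖u (r⁻¹ • (x - t))‖ₑ ∂μ
      ≤ ∫⁻ x, ENNReal.ofReal A * ENNReal.ofReal ((1 + dist x t / r) ^ (-(s + 1))) ∂μ := by
        refine lintegral_mono fun x => ?_
        rw [← ENNReal.ofReal_mul hA0, ← ofReal_norm]
        refine ENNReal.ofReal_le_ofReal ((hA _).trans_eq ?_)
        rw [norm_smul, norm_inv, Real.norm_of_nonneg hr.le, dist_eq_norm, div_eq_inv_mul]
    _ = ENNReal.ofReal A * ∫⁻ x, ENNReal.ofReal ((1 + dist x t / r) ^ (-(s + 1))) ∂μ :=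
        lintegral_const_mul' _ _ ENNReal.ofReal_ne_top
    _ ≤ ENNReal.ofReal A * (C * ENNReal.ofReal (r ^ s)) := by gcongr; exact hC t r hr
    _ = _ := by rw [ENNReal.coe_mul, mul_assoc]; rfl

/-- `𝓕⁻ (φ χ) = 𝓕⁻ φ ⋆ 𝓕⁻ χ` for test functions `φ` and `χ`. -/
theorem fourierInv_mul_eq_integral {V : Type*} [NormedAddCommGroup V] [InnerProductSpace ℝ V]
    [FiniteDimensional ℝ V] [MeasurableSpace V] [BorelSpace V] (φ χ : 𝓢(V, ℂ)) (x : V) :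
    𝓕⁻ (fun ξ => φ ξ * χ ξ) x = ∫ t, 𝓕⁻ φ t * 𝓕⁻ χ (x - t) := by
  have h := SchwartzMap.convolution_apply (ContinuousLinearMap.mul ℂ ℂ) (𝓕⁻ φ) (𝓕⁻ χ) x
  have h2 : SchwartzMap.convolution (ContinuousLinearMap.mul ℂ ℂ) (𝓕⁻ φ) (𝓕⁻ χ) =
      𝓕⁻ (SchwartzMap.pairing (ContinuousLinearMap.mul ℂ ℂ) φ χ) := by
    simp [SchwartzMap.convolution]
  rw [h2, SchwartzMap.fourierInv_coe] at h
  exact h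

/-- If `μ` of dimension `s < d` annihilates all band-limited functions whose spectrum avoids the
origin, then it annihilates all band-limited functions. -/
theorem IsNice.integral_fourierInv_eq_zero (hs : 0 < s) (hsd : s < d) (hμ : IsNice s Λ μ)
    (h : ∀ φ : EuclideanSpace ℝ (Fin d) → ℂ, ContDiff ℝ ∞ φ → HasCompactSupport φ →
      0 ∉ tsupport φ → ∫ y, 𝓕⁻ φ y ∂μ = 0)
    {φ : EuclideanSpace ℝ (Fin d) → ℂ} (hφ : ContDiff ℝ ∞ φ) (hφc : HasCompactSupport φ) :
    ∫ y, 𝓕⁻ φ y ∂μ = 0 := by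
  have := hμ.locallyFinite
  set Θ : EuclideanSpace ℝ (Fin d) → ℂ := fun ξ => (unitBump d ξ : ℂ) with hΘ
  have hΘs : ContDiff ℝ ∞ Θ := Complex.ofRealCLM.contDiff.comp (unitBump d).contDiff
  have hΘc : HasCompactSupport Θ := (unitBump d).hasCompactSupport.comp_left Complex.ofReal_zero
  have hΘ1 : ∀ᶠ ξ in 𝓝 0, Θ ξ = 1 := by
    filter_upwards [(unitBump d).eventuallyEq_one] with ξ hξ
    simp [hΘ, hξ]
  set Φ := hφc.toSchwartzMap hφ with hΦ
  obtain ⟨C, hC⟩ := hμ.exists_lintegral_schwartz_dilation_le hs (𝓕⁻ (hΘc.toSchwartzMap hΘs))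
  set M : ℝ≥0∞ := (∫⁻ t, ‖𝓕⁻ Φ t‖ₑ) * C with hM
  have hMtop : M ≠ ⊤ :=
    ENNReal.mul_ne_top (𝓕⁻ Φ).integrable.hasFiniteIntegral.ne ENNReal.coe_ne_top
  -- Split `φ` by `Θ (r • ·)`. The part vanishing near `0` is annihilated by assumption. The other
  -- part has inverse transform `𝓕⁻ φ ⋆ r^{-d} 𝓕⁻ Θ(·/r)`; each translate of the dilated factor has
  -- `μ`-mass `O(r^s)`, giving `r^{s-d}` in total.
  have key : ∀ r : ℝ, 0 < r → ‖∫ y, 𝓕⁻ φ y ∂μ‖ₑ ≤ M * ENNReal.ofReal (r ^ (s - d)) := by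
    intro r hr
    have hΘrs : ContDiff ℝ ∞ fun ξ => Θ (r • ξ) := hΘs.comp (contDiff_const_smul r)
    have hΘrc : HasCompactSupport fun ξ => Θ (r • ξ) := hΘc.comp_smul hr.ne'
    set Θr := hΘrc.toSchwartzMap hΘrs with hΘr
    have hΘrx : ∀ ξ, Θr ξ = Θ (r • ξ) := fun ξ => rfl
    have hb : ∀ z, 𝓕⁻ Θr z = ((r ^ d)⁻¹ : ℝ) • 𝓕⁻ (hΘc.toSchwartzMap hΘs) (r⁻¹ • z) := by
      intro z
      have := fourierInv_comp_smul Θ hr z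
      rw [finrank_euclideanSpace_fin] at this
      rw [SchwartzMap.fourierInv_coe, SchwartzMap.fourierInv_coe]
      exact this
    have h1s : ContDiff ℝ ∞ fun ξ => φ ξ * Θ (r • ξ) := hφ.mul hΘrs
    have h1c : HasCompactSupport fun ξ => φ ξ * Θ (r • ξ) := hφc.mul_right
    have h2s : ContDiff ℝ ∞ fun ξ => φ ξ * (1 - Θ (r • ξ)) := hφ.mul (contDiff_const.sub hΘrs)
    have h2c : HasCompactSupport fun ξ => φ ξ * (1 - Θ (r • ξ)) := hφc.mul_right
    have h20 : (0 : EuclideanSpace ℝ (Fin d)) ∉ tsupport fun ξ => φ ξ * (1 - Θ (r • ξ)) := by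
      rw [notMem_tsupport_iff_eventuallyEq]
      have : Tendsto (fun ξ : EuclideanSpace ℝ (Fin d) => r • ξ) (𝓝 0) (𝓝 0) := by
        have := (continuous_const_smul r).tendsto (0 : EuclideanSpace ℝ (Fin d))
        rwa [smul_zero] at this
      filter_upwards [this.eventually hΘ1] with ξ hξ
      simp [hξ]
    have hsplit : ∀ y, 𝓕⁻ φ y =
        (𝓕⁻ (h1c.toSchwartzMap h1s)) y + (𝓕⁻ (h2c.toSchwartzMap h2s)) y := by
      intro y
      have : Φ = h1c.toSchwartzMap h1s + h2c.toSchwartzMap h2s := by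
        ext ξ
        change φ ξ = φ ξ * Θ (r • ξ) + φ ξ * (1 - Θ (r • ξ))
        ring
      rw [← _root_.add_apply, ← FourierTransform.fourierInv_add, ← this, SchwartzMap.fourierInv_coe]
      rfl
    have hI : ∫ y, 𝓕⁻ φ y ∂μ = ∫ y, (∫ t, 𝓕⁻ Φ t * 𝓕⁻ Θr (y - t)) ∂μ := by
      simp_rw [hsplit]
      rw [integral_add (hμ.integrable_schwartz hs _) (hμ.integrable_schwartz hs _)]
      have h3 := h _ h2s h2c h20
      rw [SchwartzMap.fourierInv_coe, SchwartzMap.fourierInv_coe]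
      refine (congrArg₂ (· + ·) ?_ h3).trans (add_zero _)
      congr 1; funext y
      rw [← fourierInv_mul_eq_integral]
      rfl
    rw [hI]
    calc ‖∫ y, (∫ t, 𝓕⁻ Φ t * 𝓕⁻ Θr (y - t)) ∂μ‖ₑ
        ≤ ∫⁻ y, ‖∫ t, 𝓕⁻ Φ t * 𝓕⁻ Θr (y - t)‖ₑ ∂μ := enorm_integral_le_lintegral_enorm _
      _ ≤ ∫⁻ y, (∫⁻ t, ‖𝓕⁻ Φ t‖ₑ * ‖𝓕⁻ Θr (y - t)‖ₑ) ∂μ := by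
          refine lintegral_mono fun y => (enorm_integral_le_lintegral_enorm _).trans_eq ?_
          simp_rw [enorm_mul]
      _ = ∫⁻ t, (∫⁻ y, ‖𝓕⁻ Φ t‖ₑ * ‖𝓕⁻ Θr (y - t)‖ₑ ∂μ) := by
          refine lintegral_lintegral_swap (Measurable.aemeasurable ?_)
          exact (((𝓕⁻ Φ).continuous.comp continuous_snd).enorm.measurable).mul
            ((𝓕⁻ Θr).continuous.comp (continuous_fst.sub continuous_snd)).enorm.measurable
      _ ≤ ∫⁻ t, ‖𝓕⁻ Φ t‖ₑ * (C * ENNReal.ofReal (r ^ (s - d))) := by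
          refine lintegral_mono fun t => ?_
          rw [lintegral_const_mul' _ _ enorm_ne_top]
          gcongr
          simp_rw [hb, enorm_smul]
          rw [lintegral_const_mul' _ _ enorm_ne_top]
          refine (mul_le_mul_right (hC t r hr) _).trans_eq ?_
          rw [Real.enorm_of_nonneg (by positivity), mul_left_comm,
            ← ENNReal.ofReal_mul (by positivity), Real.rpow_sub hr, Real.rpow_natCast,
            div_eq_inv_mul]
      _ = M * ENNReal.ofReal (r ^ (s - d)) := by
          rw [lintegral_mul_const'' _ (𝓕⁻ Φ).continuous.enorm.aemeasurable, hM, mul_assoc]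
  have hlim : Tendsto (fun r : ℝ => M * ENNReal.ofReal (r ^ (s - d))) atTop (𝓝 0) := by
    have h1 := tendsto_rpow_neg_atTop (sub_pos.mpr hsd)
    rw [neg_sub] at h1
    have h2 := ENNReal.Tendsto.const_mul (ENNReal.tendsto_ofReal h1) (Or.inr hMtop)
    simpa using h2
  have h0 := ge_of_tendsto hlim ((eventually_gt_atTop 0).mono key)
  simpa using h0

theorem conj_fourierInv_of_even {V : Type*} [NormedAddCommGroup V] [InnerProductSpace ℝ V]
    [FiniteDimensional ℝ V] [MeasurableSpace V] [BorelSpace V] {f : V → ℝ}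
    (hf : ∀ x, f (-x) = f x) (x : V) :
    (starRingEnd ℂ) (𝓕⁻ (fun ξ => (f ξ : ℂ)) x) = 𝓕⁻ (fun ξ => (f ξ : ℂ)) x := by
  rw [Real.fourierInv_eq, ← integral_conj, ← integral_neg_eq_self]
  congr 1; funext ξ
  simp only [Circle.smul_def, smul_eq_mul, map_mul, Complex.conj_ofReal, hf]
  rw [inner_neg_left, AddChar.map_neg_eq_inv, Circle.coe_inv_eq_conj, Complex.conj_conj]

/-- A test function on the frequency side whose inverse Fourier transform is nonnegative, and
positive at the origin. -/
theorem exists_fourierInv_nonneg (d : ℕ) : ∃ φ : 𝓢(EuclideanSpace ℝ (Fin d), ℂ),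
    HasCompactSupport φ ∧ ∃ g : EuclideanSpace ℝ (Fin d) → ℝ,
      (∀ x, 𝓕⁻ φ x = g x) ∧ (∀ x, 0 ≤ g x) ∧ 0 < g 0 := by
  set Θ : EuclideanSpace ℝ (Fin d) → ℂ := fun ξ => (unitBump d ξ : ℂ) with hΘ
  have hΘs : ContDiff ℝ ∞ Θ := Complex.ofRealCLM.contDiff.comp (unitBump d).contDiff
  have hΘc : HasCompactSupport Θ := (unitBump d).hasCompactSupport.comp_left Complex.ofReal_zero
  set u := hΘc.toSchwartzMap hΘs with hu
  have hux : (u : EuclideanSpace ℝ (Fin d) → ℂ) = Θ := rfl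
  have hreal : ∀ x, 𝓕⁻ Θ x = ((𝓕⁻ Θ x).re : ℂ) := fun x =>
    (Complex.conj_eq_iff_re.mp (conj_fourierInv_of_even (fun ξ => (unitBump d).neg ξ) x)).symm
  -- The self-convolution of an even real bump has the square of a real function as inverse
  -- transform, and its support stays compact.
  have hinv : ∀ x, 𝓕⁻ (SchwartzMap.convolution (ContinuousLinearMap.mul ℂ ℂ) u u) x =
      (((𝓕⁻ Θ x).re ^ 2 : ℝ) : ℂ) := by
    intro x
    rw [SchwartzMap.fourierInv_coe, Real.fourierInv_eq_fourier_neg, ← SchwartzMap.fourier_coe,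
      SchwartzMap.fourier_convolution]
    change 𝓕 u (-x) * 𝓕 u (-x) = _
    rw [SchwartzMap.fourier_coe, ← Real.fourierInv_eq_fourier_neg, hux, hreal]
    push_cast
    simp [sq]
  refine ⟨SchwartzMap.convolution (ContinuousLinearMap.mul ℂ ℂ) u u, ?_,
    fun x => (𝓕⁻ Θ x).re ^ 2, hinv, fun x => sq_nonneg _, ?_⟩
  · have : (SchwartzMap.convolution (ContinuousLinearMap.mul ℂ ℂ) u u :
        EuclideanSpace ℝ (Fin d) → ℂ) = convolution u u (ContinuousLinearMap.mul ℂ ℂ) volume :=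
      funext fun x => SchwartzMap.convolution_apply _ u u x
    rw [this]
    exact hΘc.convolution _ hΘc
  · have h1 : 𝓕⁻ Θ 0 = ((∫ ξ, unitBump d ξ : ℝ) : ℂ) := by
      rw [Real.fourierInv_eq, ← integral_complex_ofReal]
      simp [hΘ]
    change 0 < (𝓕⁻ Θ 0).re ^ 2
    rw [h1, Complex.ofReal_re]
    exact pow_pos (unitBump d).integral_pos 2

/-- Modulation by `-y` moves the nonnegative test function to `y`. It has `μ`-integral zero and is
positive near `y`, so `y` has a `μ`-null neighbourhood; locally null sets are null here. -/
theorem IsNice.eq_zero_of_integral_fourierInv_eq_zero (hs : 0 < s) (hμ : IsNice s Λ μ)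
    (h : ∀ φ : EuclideanSpace ℝ (Fin d) → ℂ, ContDiff ℝ ∞ φ → HasCompactSupport φ →
      ∫ y, 𝓕⁻ φ y ∂μ = 0) : μ = 0 := by
  obtain ⟨φ, hφc, g, hg, hg0, hgpos⟩ := exists_fourierInv_nonneg d
  have hgc : Continuous g := by
    have : g = fun x => (𝓕⁻ φ x).re := funext fun x => by rw [hg, Complex.ofReal_re]
    rw [this]
    exact Complex.continuous_re.comp (𝓕⁻ φ).continuous
  rw [← Measure.measure_univ_eq_zero]
  refine measure_null_of_locally_null _ fun y _ => ?_
  have hms : ContDiff ℝ ∞ (modulate (-y) φ) := contDiff_modulate _ (φ.smooth ⊤)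
  have hmc : HasCompactSupport (modulate (-y) φ) := hasCompactSupport_modulate _ hφc
  have hmx : ∀ x, 𝓕⁻ (modulate (-y) φ) x = ((g (x - y) : ℝ) : ℂ) := fun x => by
    rw [fourierInv_modulate, ← sub_eq_add_neg, ← hg, SchwartzMap.fourierInv_coe]
  have hint : Integrable (fun x => g (x - y)) μ := by
    have h1 := (hμ.integrable_schwartz hs (𝓕⁻ (hmc.toSchwartzMap hms))).re
    refine h1.congr (Eventually.of_forall fun x => ?_)
    have : (𝓕⁻ (hmc.toSchwartzMap hms)) x = ((g (x - y) : ℝ) : ℂ) := by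
      rw [SchwartzMap.fourierInv_coe]
      exact hmx x
    simp [this]
  have hzero : ∫ x, g (x - y) ∂μ = 0 := by
    have h1 := h _ hms hmc
    simp_rw [hmx] at h1
    rw [integral_complex_ofReal] at h1
    exact_mod_cast h1
  rw [integral_eq_zero_iff_of_nonneg (fun x => hg0 _) hint] at hzero
  refine ⟨{x | g (x - y) ≠ 0}, mem_nhdsWithin_of_mem_nhds ?_, hzero⟩
  exact (hgc.comp (continuous_sub_right y)).continuousAt.eventually_ne (by simpa using hgpos.ne')

/-- The value `K 0` matters only at `y = x`, which is `μ`-null because `μ` has no atoms. -/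
theorem pairDirac_congr_kernel [NullSingletonClass μ]
    {K K' : EuclideanSpace ℝ (Fin d) → EuclideanSpace ℂ (Fin d')} (hK : ∀ x, x ≠ 0 → K x = K' x)
    (x : EuclideanSpace ℝ (Fin d)) (φ : EuclideanSpace ℝ (Fin d) → ℝ) :
    pairDirac K μ x φ = pairDirac K' μ x φ := by
  refine integral_congr_ae ?_
  filter_upwards [Measure.ae_ne μ x] with y hy
  rw [hK _ (sub_ne_zero.mpr hy)]

/-- Here `K 0` is always multiplied by `antisym` on the diagonal, which is zero, so atoms play no
role. -/
theorem pairSmooth_congr_kernel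
    {K K' : EuclideanSpace ℝ (Fin d) → EuclideanSpace ℂ (Fin d')} (hK : ∀ x, x ≠ 0 → K x = K' x)
    (f φ : EuclideanSpace ℝ (Fin d) → ℝ) : pairSmooth K μ f φ = pairSmooth K' μ f φ := by
  refine integral_congr_ae (Eventually.of_forall fun p => ?_)
  by_cases h : p.1 = p.2
  · have : antisym f φ p.1 p.2 = 0 := by rw [antisym, h]; ring
    simp only [this, zero_smul]
  · simp only [hK _ (sub_ne_zero.mpr h)]

theorem Tbar_congr_kernel [NullSingletonClass μ]
    {K K' : EuclideanSpace ℝ (Fin d) → EuclideanSpace ℂ (Fin d')} (hK : ∀ x, x ≠ 0 → K x = K' x)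
    (η φ : EuclideanSpace ℝ (Fin d) → ℝ) : Tbar K μ η φ = Tbar K' μ η φ := by
  funext x
  simp only [Tbar, pairDirac_congr_kernel hK, pairSmooth_congr_kernel hK]

theorem HasFourierMultiplier.congr_kernel [Nontrivial (EuclideanSpace ℝ (Fin d))]
    {K K' : EuclideanSpace ℝ (Fin d) → EuclideanSpace ℂ (Fin d')} (hK : ∀ x, x ≠ 0 → K x = K' x)
    (h : HasFourierMultiplier s K m) : HasFourierMultiplier s K' m := by
  intro f hf
  rw [← h f hf]
  refine integral_congr_ae ?_
  filter_upwards [Measure.ae_ne volume (0 : EuclideanSpace ℝ (Fin d))] with x hx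
  rw [hK x hx]

end WienerCZ

theorem lemma7p3 {d d' : ℕ} (hd : 2 ≤ d) (s : ℝ) (hs : 0 < s) (hsd : s < d)
    (K : EuclideanSpace ℝ (Fin d) → EuclideanSpace ℂ (Fin d'))
    (hK : WienerCZ.IsCZKernel s K) (hKhom : WienerCZ.IsHomogeneousKernel s K)
    (hKsmooth : WienerCZ.SmoothOnSphere hd (WienerCZ.angularPart K))
    (m : Metric.sphere (0 : EuclideanSpace ℝ (Fin d)) 1 → EuclideanSpace ℂ (Fin d'))
    (hmcont : Continuous m) (hm : WienerCZ.HasFourierMultiplier s K m)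
    (hmne : ∀ θ, m θ ≠ 0)
    (Λ : ℝ) (hΛ : 0 < Λ) (μ : MeasureTheory.Measure (EuclideanSpace ℝ (Fin d)))
    (hμ : WienerCZ.IsNice s Λ μ)
    (η : EuclideanSpace ℝ (Fin d) → ℝ) (hη : WienerCZ.IsBalancing μ η)
    (Γ : EuclideanSpace ℂ (Fin d'))
    (hT : ∀ᵐ x ∂(MeasureTheory.volume : MeasureTheory.Measure (EuclideanSpace ℝ (Fin d))),
      WienerCZ.DiracBounded s μ x → WienerCZ.Tbar K μ η (fun _ => 1) x = Γ) :
    μ = 0 := by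
  -- The normalization `∫ η dμ = 1` is only available for `μ ≠ 0`.
  by_contra hμ0
  have : Nonempty (Fin d) := ⟨⟨0, by omega⟩⟩
  have := hμ.nullSingletonClass hs
  have hKi : ∀ x, x ≠ 0 → K x = ({0}ᶜ : Set (EuclideanSpace ℝ (Fin d))).indicator K x :=
    fun x hx => (Set.indicator_of_mem hx K).symm
  have hK' := hK.isSmoothKernel_indicator hd hKhom hKsmooth
  rw [WienerCZ.Tbar_congr_kernel hKi] at hT
  refine hμ0 (hμ.eq_zero_of_integral_fourierInv_eq_zero hs fun φ hφ hφc =>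
    hμ.integral_fourierInv_eq_zero hs hsd (fun ψ hψ hψc hψ0 => ?_) hφ hφc)
  exact hK'.integral_fourierInv_eq_zero_of_notMem_tsupport hs hsd hmcont (hm.congr_kernel hKi) hmne
    (hK'.integral_smul_kernel_eq_zero hs hsd hμ hη.1 (hη.2 hμ0) hT) hψ hψc hψ0
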